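/- **The spaces.** Let $\mathbb{T}_0(n)=\{\langle\rangle,\langle n\rangle\}$ and $\mathbb{T}_{k+1}(n)=\{\langle\rangle\}\cup\{\langle n\rangle^\frown x: x\in \bigcup_{i\le n}\mathbb{T}_k(i)\}$, and let $\mathbb{T}_k=\bigcup_{n<\omega}\mathbb{T}_k(n)$, a tree of finite sequences of natural numbers. The members of $\mathcal{R}_k$ are the subtrees $X\subseteq\mathbb{T}_k$ for which there is a strictly increasing sequence $(\kappa_n)_{n<\omega}$ such that $X(n):=X\cap\mathbb{T}_k(\kappa_n)$ is isomorphic to $\mathbb{T}_k(n)$ (by a bijection preserving the initial segment relation and the lexicographic order) for each $n$, and $X$ meets $\mathbb{T}_k(j)\setminus\{\langle\rangle\}$ only if $j=\kappa_n$ for some $n$. Write $r_1(X)=X(0)$. Let $Y\le X$ mean that there is a strictly increasing sequence $(l_n)_{n<\omega}$ with $Y(n)\subseteq X(l_n)$ for all $n$, and let $Y\le^* X$ mean that $Y\setminus X$ is finite. Put $\mathcal{AR}_1=\{r_1(A):A\in\mathcal{R}_k\}$ and $\mathcal{AR}_1{\restriction}X=\{r_1(Y):Y\le X\}$. **The ultrafilter.**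 For a generic filter $G$ of the forcing $(\mathcal{R}_k,\le^*)$ let, in the generic extension, $\mathcal{U}_k=\{S\subseteq\mathcal{AR}_1: \mathcal{AR}_1{\restriction}A\subseteq S\text{ for some }A\in G\}$. More generally, if $Q$ is a forcing notion, $e:(\mathcal{R}_k,\le^*)\to Q$ is a dense embedding (order preserving, incompatibility preserving, with dense range) and $H$ is a generic filter of $Q$, let $\mathcal{U}_k$ be defined in the same way from $G=e^{-1}(H)$. **Ramsey degrees.** For an ultrafilter $\mathcal{U}$ on a countable set $S$ and $n\ge1$, $t(\mathcal{U},n)$ is the least number $t$, if it exists, such that for each $l\ge2$ and each coloring $c:[S]^n\to l$ there is $X\in\mathcal{U}$ such that $c$ takes at most $t$ colors on $[X]^n$. **Theorem.** Let $k,n\ge1$. It is forced by $(\mathcal{R}_k,\le^*)$, and equally by every forcing notion $Q$ into which $(\mathcal{R}_k,\le^*)$ embeds densely, that $\mathcal{U}_k$ is an ultrafilter on $\mathcal{AR}_1$ and that its Ramsey degree exists and is $$t(\mathcal{U}_k,n)=(k+1)^{n-1}.$$ In particular, $t(\mathcal{U}_1,n)=2^{n-1}$. -/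

import Mathlib

namespace LaflammeRamsey

/-! ## The forcing relation

`P` is a forcing notion; `q ≤ p` means that `q` is the stronger condition. A sentence of the forcing
language is represented by the set of the conditions that force it, and is built up by the usual
recursive clauses of the forcing relation. -/

/-- A sentence `φ` of the forcing language of `P`; `φ p` is read `p ⊩ φ`. -/
abbrev Sentence (P : Type*) := P → Prop

/-- A `P`-name `τ` for a subset of the ground model set `α`: its elements are pairs `(ǎ, s)` with
`a : α` and `s : P`. Every subset of `α` in the generic extension has such a name. -/
abbrev Name (α P : Type*) := Set (α × P)

namespace Sentence

variable {P : Type*} [Preorder P]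

/-- A statement about the ground model whose meaning is absolute. -/
def ground (a : Prop) : Sentence P := fun _ => a

/-- `p ⊩ ǎ ∈ τ` iff the set `{r | ∃ s, (ǎ, s) ∈ τ ∧ r ≤ s}` is dense below `p`. -/
def mem {α : Type*} (a : α) (τ : Name α P) : Sentence P :=
  fun p => ∀ q ≤ p, ∃ r ≤ q, ∃ s, (a, s) ∈ τ ∧ r ≤ s

/-- `p ⊩ ¬φ` -/
def neg (φ : Sentence P) : Sentence P := fun p => ∀ q ≤ p, ¬ φ q

/-- `p ⊩ φ ∧ ψ` -/
def conj (φ ψ : Sentence P) : Sentence P := fun p => φ p ∧ ψ p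

/-- `p ⊩ φ ∨ ψ` -/
def disj (φ ψ : Sentence P) : Sentence P := fun p => ∀ q ≤ p, ∃ r ≤ q, φ r ∨ ψ r

/-- `p ⊩ φ → ψ` -/
def imp (φ ψ : Sentence P) : Sentence P := fun p => ∀ q ≤ p, φ q → ψ q

/-- `p ⊩ φ ↔ ψ` -/
def iff (φ ψ : Sentence P) : Sentence P := conj (imp φ ψ) (imp ψ φ)

/-- `p ⊩ ∀ x, φ x`, where `x` ranges over a ground model set or over a type of names. -/
def all {ι : Type*} (φ : ι → Sentence P) : Sentence P := fun p => ∀ x, φ x p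

/-- `p ⊩ ∃ x, φ x`, where `x` ranges over a ground model set or over a type of names. -/
def ex {ι : Type*} (φ : ι → Sentence P) : Sentence P := fun p => ∀ q ≤ p, ∃ r ≤ q, ∃ x, φ x r

end Sentence

/-- `P` forces `φ`: every condition forces `φ`. -/
def Forced {P : Type*} (φ : Sentence P) : Prop := ∀ p, φ p

open Sentence

section RamseyDegree

variable {P : Type*} [Preorder P] {S : Type*}

/-- `[S]^n`, the set of the `n`-element subsets of `S`. -/
abbrev Subsets (S : Type*) (n : ℕ) := {s : Finset S // s.card = n}

/-- The sentence "`𝒰` is an ultrafilter on the base set `S`", where `𝒰` is a family of subsets of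
`S` in the extension, given by the sentences `X ∈ 𝒰` for the names `X` for subsets of `S`. -/
def isUltrafilter (𝒰 : Name S P → Sentence P) : Sentence P :=
  conj
    -- the whole set is in the family
    (all fun X : Name S P => imp (all fun s : S => mem s X) (𝒰 X)) <| conj
    -- the empty set is not
    (all fun X : Name S P => imp (all fun s : S => neg (mem s X)) (neg (𝒰 X))) <| conj
    -- closure under supersets
    (all fun X : Name S P => all fun Y : Name S P =>
      imp (conj (𝒰 X) (all fun s : S => imp (mem s X) (mem s Y))) (𝒰 Y)) <| conj
    -- closure under intersections
    (all fun X : Name S P => all fun Y : Name S P => all fun Z : Name S P =>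
      imp (conj (conj (𝒰 X) (𝒰 Y))
        (all fun s : S => iff (mem s Z) (conj (mem s X) (mem s Y)))) (𝒰 Z))
    -- a set or its complement is in the family
    (all fun X : Name S P => all fun Y : Name S P =>
      imp (all fun s : S => iff (mem s Y) (neg (mem s X))) (disj (𝒰 X) (𝒰 Y)))

/-- The sentence "`c` is a coloring `[S]^n → l`", `c` being a name for a subset of `[S]^n × l`. -/
def isColoring {n l : ℕ} (c : Name (Subsets S n × Fin l) P) : Sentence P :=
  conj
    (all fun s : Subsets S n => ex fun i : Fin l => mem (s, i) c)
    (all fun s : Subsets S n => all fun i : Fin l => all fun j : Fin l =>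
      imp (conj (mem (s, i) c) (mem (s, j) c)) (ground (i = j)))

/-- The sentence "the restriction of the coloring `c` to `[X]^n` takes no more than `t` colors". -/
def atMostColors {n l : ℕ} (c : Name (Subsets S n × Fin l) P) (X : Name S P) (t : ℕ) :
    Sentence P :=
  ex fun F : {F : Finset (Fin l) // F.card ≤ t} => all fun s : Subsets S n =>
    imp (all fun x : {x : S // x ∈ s.1} => mem x.1 X)
      (ex fun i : {i : Fin l // i ∈ F.1} => mem (s, i.1) c)

/-- The sentence "for each `l ≥ 2` and each coloring `c : [S]^n → l` there is `X ∈ 𝒰` such that the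
restriction of `c` to `[X]^n` takes no more than `t` colors". -/
def isRamseyBound (𝒰 : Name S P → Sentence P) (n t : ℕ) : Sentence P :=
  all fun l : {l : ℕ // 2 ≤ l} => all fun c : Name (Subsets S n × Fin l.1) P =>
    imp (isColoring c) (ex fun X : Name S P => conj (𝒰 X) (atMostColors c X t))

/-- The sentence "the Ramsey degree `t(𝒰, n)` exists and equals `m`". -/
def hasRamseyDegree (𝒰 : Name S P → Sentence P) (n m : ℕ) : Sentence P :=
  conj (isRamseyBound 𝒰 n m) (all fun t : {t : ℕ // t < m} => neg (isRamseyBound 𝒰 n t.1))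

end RamseyDegree

/-! ## The spaces `ℛ_k` -/

/-- The `n`-th subtree `𝕋_k(n)` of the tree `𝕋_k`: `𝕋_0(n) = {⟨⟩, ⟨n⟩}`, and `𝕋_{k+1}(n)` is the tree
`𝕋_k(0) ∪ … ∪ 𝕋_k(n)` put on top of the node `⟨n⟩`. Thus
`𝕋_1(n) = {⟨⟩, ⟨n⟩} ∪ {⟨n, i⟩ : i ≤ n}`, `𝕋_2(n) = {⟨⟩, ⟨n⟩} ∪ {⟨n, i⟩, ⟨n, i, j⟩ : j ≤ i ≤ n}`. -/
def block : ℕ → ℕ → Set (List ℕ)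
  | 0, n => {[], [n]}
  | k + 1, n => {[]} ∪ {x | ∃ i ≤ n, ∃ y ∈ block k i, x = n :: y}

/-- The tree `𝕋_k`. -/
def tree (k : ℕ) : Set (List ℕ) := ⋃ n, block k n

/-- Isomorphism of trees of finite sequences: a bijection that preserves the initial segment
relation and the lexicographic order. -/
def TreeIso (A B : Set (List ℕ)) : Prop :=
  ∃ f : A ≃ B, (∀ x y : A, (x : List ℕ) <+: y ↔ (f x : List ℕ) <+: f y) ∧
    ∀ x y : A, (x : List ℕ) < y ↔ (f x : List ℕ) < f y

/-- The members of `ℛ_k`: the subtrees of `𝕋_k` that consist of one isomorphic copy of `𝕋_k(n)` in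
`𝕋_k(κ n)` for each `n`, where `κ` (which is determined by the subtree) is strictly increasing. -/
structure RSpace (k : ℕ) where
  /-- the underlying set of nodes -/
  carrier : Set (List ℕ)
  /-- the sequence `κ` -/
  idx : ℕ → ℕ
  subset_tree : carrier ⊆ tree k
  prefix_closed : ∀ x ∈ carrier, ∀ y, y <+: x → y ∈ carrier
  idx_strictMono : StrictMono idx
  iso : ∀ n, TreeIso (carrier ∩ block k (idx n)) (block k n)
  only : ∀ j, (∃ x ∈ carrier ∩ block k j, x ≠ []) → ∃ n, j = idx n

namespace RSpace

variable {k : ℕ}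

/-- The `n`-th subtree `X(n)` of `X`. -/
def sub (X : RSpace k) (n : ℕ) : Set (List ℕ) := X.carrier ∩ block k (X.idx n)

/-- The `n`-th approximation `r_n(X) = ⋃_{i < n} X(i)`. -/
def approx (n : ℕ) (X : RSpace k) : Set (List ℕ) := ⋃ i < n, X.sub i

/-- The partial order `≤` of `ℛ_k`. -/
def Red (Y X : RSpace k) : Prop := ∃ κ : ℕ → ℕ, StrictMono κ ∧ ∀ n, Y.sub n ⊆ X.sub (κ n)

/-- The forcing notion `(ℛ_k, ≤*)`: `Y ≤* X` iff `Y ⊆* X`, that is, `Y \ X` is finite. From here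
on, `≤` on `ℛ_k` denotes this quasi-order. -/
instance : Preorder (RSpace k) where
  le Y X := (Y.carrier \ X.carrier).Finite
  le_refl X := by simp
  le_trans X Y Z h₁ h₂ := (h₁.union h₂).subset fun x hx => by
    by_cases hy : x ∈ Y.carrier
    · exact Or.inr ⟨hy, hx.2⟩
    · exact Or.inl ⟨hx.1, hy⟩

end RSpace

/-- `𝒜ℛ_1`, the set of the first approximations of members of `ℛ_k`. -/
def AR1 (k : ℕ) : Set (Set (List ℕ)) := {a | ∃ A : RSpace k, a = A.approx 1}

/-- `𝒜ℛ_1 ↾ X`, the set of the first approximations of the members `Y ≤ X` of `ℛ_k`. -/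
def AR1Below {k : ℕ} (X : RSpace k) : Set (AR1 k) :=
  {a | ∃ Y : RSpace k, Y.Red X ∧ (a : Set (List ℕ)) = Y.approx 1}

/-! ## The forced ultrafilter -/

/-- Dense embeddings of forcing notions: order preserving, incompatibility preserving, and with
dense range. -/
structure IsDenseEmb {P Q : Type*} [Preorder P] [Preorder Q] (e : P → Q) : Prop where
  mono : ∀ p p', p ≤ p' → e p ≤ e p'
  incompatible : ∀ p p', (¬ ∃ r, r ≤ p ∧ r ≤ p') → ¬ ∃ s, s ≤ e p ∧ s ≤ e p'
  dense : ∀ q, ∃ p, e p ≤ q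

/-- The name `{(Ǎ, e A) : A ∈ ℛ_k}` for the set of the `A ∈ ℛ_k` with `e A ∈ G`, where `G` is the
generic filter of `Q`. For `Q = ℛ_k`, `e = id` this is the canonical name for the generic filter. -/
def genericName {k : ℕ} {Q : Type*} (e : RSpace k → Q) : Name (RSpace k) Q :=
  {x | x.2 = e x.1}

/-- The family `𝒰_k` of subsets of `𝒜ℛ_1` in the extension by `Q` (via `e : ℛ_k → Q`): `X ∈ 𝒰_k` iff
there is `A ∈ ℛ_k` with `e A ∈ G` and `𝒜ℛ_1 ↾ A ⊆ X`. -/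
def forcedU {k : ℕ} {Q : Type*} [Preorder Q] (e : RSpace k → Q) (X : Name (AR1 k) Q) :
    Sentence Q :=
  ex fun A : RSpace k => conj (mem A (genericName e)) (all fun a : AR1Below A => mem a.1 X)

end LaflammeRamsey

namespace LaflammeRamsey

/-! ## Ramsey theory on `ℕ` -/

/-! A first approximation is the chain of initial segments of a single leaf of `tree k`, so an
`n`-element subset of `AR1 k` amounts to a lexicographically increasing sequence of `n` leaves. Its
type (`meetType`) records the levels, from `0` to `k`, at which consecutive leaves split. There are
`(k + 1) ^ (n - 1)` types, and the Ramsey degree counts them.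

Lower bound: the members of `ℛ_k` are exactly the ranges of the self-embeddings of `tree k` that
preserve lengths, initial segments and the lexicographic order (`IsEmb.toRSpace`,
`RSpace.exists_isEmb`). Such maps preserve types, and all types occur in the full tree, so all occur
below every member (`exists_subset_meetType`). Colouring by type therefore defeats every smaller
bound.

Upper bound: below some member, a finite ground model colouring depends only on the type
(`exists_canonical`). The nodes are numbered in postorder, and for increasing `H` the map that
replaces labels by the values of `H` at these numbers is an embedding (`isEmb_postMap`). It turns a
tuple of leaves into a tuple of numbers whose order type is determined by the type of the leaves, so
Ramsey's theorem in the form `orderType_ramsey` supplies a suitable `H`.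

Forcing: `(ℛ_k, ≤*)` is σ-closed (`RSpace.exists_le_forall`), so densely many conditions decide all
of a given name for a subset of a countable set (`IsDenseEmb.exists_decides`). Colourings and sets
in the extension are thus handled as ground model objects. A dense embedding serves only to bring
conditions back to `ℛ_k`; the forcing `ℛ_k` itself is the case of the identity. -/

/-- A function on tuples eventually stabilises along a nonprincipal ultrafilter in its last
variable; thinning out makes the last variable irrelevant. -/
theorem exists_strictMono_last_irrelevant {κ : Type*} [Finite κ] (N : ℕ)
    (g : (Fin (N + 1) → ℕ) → κ) :
    ∃ (g' : (Fin N → ℕ) → κ) (H : ℕ → ℕ), StrictMono H ∧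
      ∀ x : Fin (N + 1) → ℕ, StrictMono x → g (H ∘ x) = g' (H ∘ x ∘ Fin.castSucc) := by
  classical
  let U : Ultrafilter ℕ := Filter.hyperfilter ℕ
  have hlim : ∀ y : Fin N → ℕ, ∃ c, ∀ᶠ m in U, g (Fin.snoc y m) = c := by
    intro y
    have h : ∀ᶠ m in U, ∃ c, g (Fin.snoc y m) = c := Filter.Eventually.of_forall fun m => ⟨_, rfl⟩
    exact Ultrafilter.eventually_exists_iff.1 h
  choose g' hg' using hlim
  have hstep : ∀ b : ℕ, ∃ m, b < m ∧
      ∀ y : Fin N → ℕ, (∀ i, y i ≤ b) → g (Fin.snoc y m) = g' y := by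
    intro b
    have hfin : {y : Fin N → ℕ | ∀ i, y i ≤ b}.Finite := by
      have : {y : Fin N → ℕ | ∀ i, y i ≤ b} = Set.Iic (fun _ => b) := by
        ext y; simp [Pi.le_def]
      rw [this]; exact Set.finite_Iic _
    have h1 : ∀ᶠ m in (U : Filter ℕ), ∀ y ∈ {y : Fin N → ℕ | ∀ i, y i ≤ b},
        g (Fin.snoc y m) = g' y := (Filter.eventually_all_finite hfin).2 fun y _ => hg' y
    have h2 : ∀ᶠ m in (U : Filter ℕ), b < m := by
      have : ∀ᶠ m in Filter.cofinite, b < m := by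
        rw [Nat.cofinite_eq_atTop]; exact Filter.eventually_gt_atTop b
      exact Filter.hyperfilter_le_cofinite this
    obtain ⟨m, hm1, hm2⟩ := (h1.and h2).exists
    exact ⟨m, hm2, fun y hy => hm1 y hy⟩
  choose next hlt hnext using hstep
  -- Every value of `H` is `next` of a bound for all earlier values (of `0` at the start), so by the
  -- time it is used as a last entry all smaller tuples have stabilised.
  let H : ℕ → ℕ := fun n => next^[n + 1] 0
  have hsucc : ∀ n, H (n + 1) = next (H n) := fun n => Function.iterate_succ_apply' next _ 0
  have hmono : StrictMono H := strictMono_nat_of_lt_succ fun n => by rw [hsucc]; exact hlt _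
  have hval : ∀ m, ∃ b, H m = next b ∧ ∀ j < m, H j ≤ b := by
    intro m
    cases m with
    | zero => exact ⟨0, rfl, by simp⟩
    | succ m => exact ⟨H m, hsucc m, fun j hj => hmono.monotone (Nat.lt_succ_iff.1 hj)⟩
  refine ⟨g', H, hmono, fun x hx => ?_⟩
  obtain ⟨b, hb, hle⟩ := hval (x (Fin.last N))
  have := hnext b (H ∘ x ∘ Fin.castSucc) fun i => hle _ (hx (Fin.castSucc_lt_last i))
  rw [← this, ← hb]
  congr 1
  funext i
  refine Fin.lastCases ?_ (fun i => ?_) i <;> simp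

/-- The infinite Ramsey theorem, for strictly increasing tuples. -/
theorem infinite_ramsey {κ : Type*} [Finite κ] (N : ℕ) (g : (Fin N → ℕ) → κ) :
    ∃ H : ℕ → ℕ, StrictMono H ∧ ∀ x y : Fin N → ℕ, StrictMono x → StrictMono y →
      g (H ∘ x) = g (H ∘ y) := by
  induction N with
  | zero => exact ⟨id, strictMono_id, fun x y _ _ => congrArg g (Subsingleton.elim _ _)⟩
  | succ N ih =>
    obtain ⟨g', H, hH, hg⟩ := exists_strictMono_last_irrelevant N g
    obtain ⟨H', hH', hg'⟩ := ih fun y => g' (H ∘ y)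
    refine ⟨H ∘ H', hH.comp hH', fun x y hx hy => ?_⟩
    have h1 := hg (H' ∘ x) (hH'.comp hx)
    have h2 := hg (H' ∘ y) (hH'.comp hy)
    have h3 := hg' (x ∘ Fin.castSucc) (y ∘ Fin.castSucc)
      (hx.comp Fin.strictMono_castSucc) (hy.comp Fin.strictMono_castSucc)
    exact h1.trans (h3.trans h2.symm)

/-- Rank of `x i` among the values of `x`. -/
def valueRank {ι : Type*} [Fintype ι] (x : ι → ℕ) (i : ι) : ℕ :=
  ((Finset.univ.filter fun j => x j < x i).image x).card

theorem valueRank_lt {ι : Type*} [Fintype ι] (x : ι → ℕ) (i : ι) :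
    valueRank x i < Fintype.card ι := by
  refine Finset.card_image_le.trans_lt ?_
  exact Finset.card_lt_card ⟨Finset.subset_univ _, fun h => by simpa using h (Finset.mem_univ i)⟩

/-- Equal values of `x` give equal values of `y`, so `y` factors through `x`, and the `y`-values
below `y i` are an image of the `x`-values below `x i`. -/
theorem valueRank_le_of_sameOrder {ι : Type*} [Fintype ι] {x y : ι → ℕ}
    (h : ∀ i j, x i < x j ↔ y i < y j) (i : ι) : valueRank y i ≤ valueRank x i := by
  classical
  have heq : ∀ a b, x a = x b → y a = y b := fun a b hab => by
    have h1 := h a b; have h2 := h b a; omega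
  have hf : Function.FactorsThrough y x := fun a b hab => heq a b hab
  have hset : (Finset.univ.filter fun j => y j < y i) = Finset.univ.filter fun j => x j < x i := by
    ext j; simp [h j i]
  have hext : ((Finset.univ.filter fun j => x j < x i).image x).image
      (Function.extend x y fun _ => 0) = (Finset.univ.filter fun j => y j < y i).image y := by
    rw [Finset.image_image, hset]
    exact Finset.image_congr fun j _ => hf.extend_apply _ j
  unfold valueRank
  rw [← hext]
  exact Finset.card_image_le

theorem exists_strictMono_valueRank {ι : Type*} [Fintype ι] (x : ι → ℕ) :
    ∃ y : ℕ → ℕ, StrictMono y ∧ ∀ i, y (valueRank x i) = x i := by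
  classical
  -- The range of `x`, padded with all numbers above it to make it infinite; its increasing
  -- enumeration is the required `y`.
  let p : ℕ → Prop := fun m => (∃ i, x i = m) ∨ ∀ i, x i < m
  have hinf : {m | p m}.Infinite := by
    obtain ⟨b, hb⟩ := (Set.finite_range x).bddAbove
    refine Set.infinite_of_not_bddAbove ?_
    rintro ⟨c, hc⟩
    have : p (b + c + 1) := Or.inr fun i => by
      have := hb ⟨i, rfl⟩
      omega
    have := hc this
    omega
  refine ⟨Nat.nth p, Nat.nth_strictMono hinf, fun i => ?_⟩
  have hcount : valueRank x i = Nat.count p (x i) := by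
    rw [Nat.count_eq_card_filter_range]
    unfold valueRank
    congr 1
    ext m
    simp only [Finset.mem_image, Finset.mem_filter, Finset.mem_univ, true_and, Finset.mem_range]
    constructor
    · rintro ⟨j, hj, rfl⟩
      exact ⟨hj, Or.inl ⟨j, rfl⟩⟩
    · rintro ⟨hm, ⟨j, rfl⟩ | hj⟩
      · exact ⟨j, hm, rfl⟩
      · exact absurd (hj i) (by omega)
  rw [hcount]
  exact Nat.nth_count (Or.inl ⟨i, rfl⟩)

/-- Every finite colouring of tuples depends, after thinning out, only on the order type. -/
theorem orderType_ramsey {ι κ : Type*} [Fintype ι] [Finite κ] (C : (ι → ℕ) → κ) :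
    ∃ H : ℕ → ℕ, StrictMono H ∧ ∀ x y : ι → ℕ, (∀ i j, x i < x j ↔ y i < y j) →
      C (H ∘ x) = C (H ∘ y) := by
  -- A tuple is an increasing sequence composed with its rank function. Colouring a sequence by the
  -- whole function `r ↦ C (z ∘ r)` treats all the finitely many rank functions at once.
  obtain ⟨H, hH, hC⟩ := infinite_ramsey (Fintype.card ι)
    fun z (r : ι → Fin (Fintype.card ι)) => C (z ∘ r)
  refine ⟨H, hH, fun x y hxy => ?_⟩
  obtain ⟨u, hu, hux⟩ := exists_strictMono_valueRank x
  obtain ⟨v, hv, hvy⟩ := exists_strictMono_valueRank y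
  have hr : ∀ i, valueRank x i = valueRank y i := fun i =>
    le_antisymm (valueRank_le_of_sameOrder (fun a b => (hxy a b).symm) i)
      (valueRank_le_of_sameOrder hxy i)
  have key := congrFun (hC (u ∘ Fin.val) (v ∘ Fin.val) (hu.comp Fin.val_strictMono)
    (hv.comp Fin.val_strictMono)) fun i => ⟨valueRank x i, valueRank_lt x i⟩
  have hx : x = fun i => u (valueRank x i) := funext fun i => (hux i).symm
  have hy : y = fun i => v (valueRank x i) := funext fun i => by rw [hr, hvy]
  have h1 : C (H ∘ x) = C (H ∘ fun i => u (valueRank x i)) := by rw [← hx]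
  have h2 : C (H ∘ y) = C (H ∘ fun i => v (valueRank x i)) := by rw [← hy]
  rw [h1, h2]
  exact key

theorem take_isPrefix (j : ℕ) (x : List ℕ) : x.take j <+: x := ⟨x.drop j, List.take_append_drop j x⟩

theorem nil_isPrefix (x : List ℕ) : [] <+: x := ⟨x, rfl⟩

/-! ## Nodes of the tree `𝕋_k` -/

theorem nil_mem_block (k n : ℕ) : [] ∈ block k n := by
  cases k <;> simp [block]

theorem cons_mem_block_iff {k n m : ℕ} {y : List ℕ} :
    m :: y ∈ block k n ↔ m = n ∧ y.length ≤ k ∧ (m :: y).Pairwise (· ≥ ·) := by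
  induction k generalizing n m y with
  | zero =>
    constructor
    · intro h
      simp [block] at h
      obtain ⟨rfl, rfl⟩ := h
      simp
    · rintro ⟨rfl, h, -⟩
      obtain rfl : y = [] := List.length_eq_zero_iff.1 (by omega)
      simp [block]
  | succ k ih =>
    constructor
    · intro h
      simp only [block, Set.singleton_union, Set.mem_insert_iff, reduceCtorEq, false_or,
        Set.mem_ofPred_eq, List.cons.injEq] at h
      obtain ⟨i, hi, y', hy', rfl, rfl⟩ := h
      refine ⟨rfl, ?_⟩
      cases y with
      | nil => simp
      | cons a y =>
        obtain ⟨rfl, hl, hp⟩ := ih.1 hy'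
        refine ⟨by simpa using hl, List.pairwise_cons.2 ⟨?_, hp⟩⟩
        intro b hb
        rcases List.mem_cons.1 hb with rfl | hb
        · exact hi
        · exact le_trans ((List.pairwise_cons.1 hp).1 b hb) hi
    · rintro ⟨rfl, hl, hp⟩
      right
      cases y with
      | nil => exact ⟨0, Nat.zero_le _, [], nil_mem_block _ _, rfl⟩
      | cons a y =>
        refine ⟨a, (List.pairwise_cons.1 hp).1 a (by simp), a :: y, ?_, rfl⟩
        exact ih.2 ⟨rfl, by simpa using hl, (List.pairwise_cons.1 hp).2⟩

theorem mem_tree_iff {k : ℕ} {x : List ℕ} :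
    x ∈ tree k ↔ x.length ≤ k + 1 ∧ x.Pairwise (· ≥ ·) := by
  unfold tree
  rw [Set.mem_iUnion]
  cases x with
  | nil => simp [nil_mem_block]
  | cons m y => simp [cons_mem_block_iff]

theorem cons_mem_block {k n m : ℕ} {y : List ℕ} :
    m :: y ∈ block k n ↔ m = n ∧ m :: y ∈ tree k := by
  rw [cons_mem_block_iff, mem_tree_iff, List.length_cons, Nat.add_le_add_iff_right]

theorem block_subset_tree (k n : ℕ) : block k n ⊆ tree k :=
  Set.subset_iUnion (block k) n

theorem nil_mem_tree (k : ℕ) : [] ∈ tree k := by simp [mem_tree_iff]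

theorem singleton_mem_tree (k n : ℕ) : [n] ∈ tree k := by simp [mem_tree_iff]

theorem mem_tree_of_isPrefix {k : ℕ} {x y : List ℕ} (hx : x ∈ tree k) (h : y <+: x) :
    y ∈ tree k := by
  rw [mem_tree_iff] at *
  exact ⟨h.length_le.trans hx.1, hx.2.sublist h.sublist⟩

theorem mem_block_of_isPrefix {k n : ℕ} {x y : List ℕ} (hx : x ∈ block k n) (h : y <+: x) :
    y ∈ block k n := by
  cases y with
  | nil => exact nil_mem_block _ _
  | cons a y =>
    obtain ⟨t, rfl⟩ := h
    obtain ⟨rfl, h'⟩ := cons_mem_block.1 hx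
    exact cons_mem_block.2 ⟨rfl, mem_tree_of_isPrefix h' ⟨t, rfl⟩⟩

/-- Raising the first entry of a node. -/
theorem cons_mem_tree_of_le {k m n : ℕ} {y : List ℕ} (h : n :: y ∈ tree k) (hnm : n ≤ m) :
    m :: y ∈ tree k := by
  rw [mem_tree_iff] at *
  refine ⟨by simpa using h.1, List.pairwise_cons.2 ⟨fun b hb => ?_, (List.pairwise_cons.1 h.2).2⟩⟩
  exact le_trans ((List.pairwise_cons.1 h.2).1 b hb) hnm

theorem finite_block (k n : ℕ) : (block k n).Finite := by
  induction k generalizing n with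
  | zero => simp [block]
  | succ k ih =>
    refine (Set.finite_singleton _).union ?_
    refine ((((Set.finite_Iic n).biUnion fun i _ => ih i).image (List.cons n))).subset ?_
    rintro x ⟨i, hi, y, hy, rfl⟩
    exact ⟨y, Set.mem_biUnion hi hy, rfl⟩

/-! ## The lexicographic order -/

theorem append_lt_append_of_lt {p s t : List ℕ} {a b : ℕ} (h : a < b) :
    p ++ a :: s < p ++ b :: t := by
  induction p with
  | nil => exact List.cons_lt_cons_iff.2 (Or.inl h)
  | cons c p ih => exact List.cons_lt_cons_iff.2 (Or.inr ⟨rfl, ih⟩)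

theorem prefix_or_exists_of_lt {x y : List ℕ} (h : x < y) :
    x <+: y ∨ ∃ p a b s t, x = p ++ a :: s ∧ y = p ++ b :: t ∧ a < b := by
  induction x generalizing y with
  | nil => exact Or.inl (nil_isPrefix _)
  | cons c x ih =>
    cases y with
    | nil => exact absurd h (List.not_lt_nil _)
    | cons d y =>
      rcases List.cons_lt_cons_iff.1 h with h | ⟨rfl, hxy⟩
      · exact Or.inr ⟨[], c, d, x, y, rfl, rfl, h⟩
      · rcases ih hxy with hp | ⟨p, a, b, s, t, rfl, rfl, hab⟩
        · exact Or.inl (List.cons_prefix_cons.2 ⟨rfl, hp⟩)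
        · exact Or.inr ⟨c :: p, a, b, s, t, rfl, rfl, hab⟩

theorem lt_of_prefix_of_ne {x y : List ℕ} (h : x <+: y) (hne : x ≠ y) : x < y := by
  obtain ⟨t, rfl⟩ := h
  induction x with
  | nil =>
    cases t with
    | nil => exact absurd rfl hne
    | cons a t => exact List.nil_lt_cons _ _
  | cons a x ih =>
    exact List.cons_lt_cons_iff.2 (Or.inr ⟨rfl, ih fun h => hne (congrArg (List.cons a) h)⟩)

/-! ## Embeddings of `𝕋_k` into itself -/

/-- `φ` maps `𝕋_k` into itself, preserving lengths, initial segments and the lexicographic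
order. -/
structure IsEmb (k : ℕ) (φ : List ℕ → List ℕ) : Prop where
  mem : ∀ x ∈ tree k, φ x ∈ tree k
  length : ∀ x ∈ tree k, (φ x).length = x.length
  pre : ∀ x ∈ tree k, ∀ y ∈ tree k, x <+: y → φ x <+: φ y
  lt : ∀ x ∈ tree k, ∀ y ∈ tree k, x < y → φ x < φ y

namespace IsEmb

variable {k : ℕ} {φ ψ : List ℕ → List ℕ}

theorem comp (hφ : IsEmb k φ) (hψ : IsEmb k ψ) : IsEmb k (φ ∘ ψ) where
  mem x hx := hφ.mem _ (hψ.mem x hx)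
  length x hx := (hφ.length _ (hψ.mem x hx)).trans (hψ.length x hx)
  pre x hx y hy h := hφ.pre _ (hψ.mem x hx) _ (hψ.mem y hy) (hψ.pre x hx y hy h)
  lt x hx y hy h := hφ.lt _ (hψ.mem x hx) _ (hψ.mem y hy) (hψ.lt x hx y hy h)

theorem injOn (hφ : IsEmb k φ) : Set.InjOn φ (tree k) := by
  intro x hx y hy h
  rcases lt_trichotomy x y with hlt | rfl | hlt
  · exact absurd h (hφ.lt x hx y hy hlt).ne
  · rfl
  · exact absurd h (hφ.lt y hy x hx hlt).ne'

theorem lt_iff (hφ : IsEmb k φ) {x y : List ℕ} (hx : x ∈ tree k) (hy : y ∈ tree k) :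
    φ x < φ y ↔ x < y := by
  refine ⟨fun h => ?_, hφ.lt x hx y hy⟩
  rcases lt_trichotomy x y with hlt | rfl | hlt
  · exact hlt
  · exact absurd h (lt_irrefl _)
  · exact absurd h (hφ.lt y hy x hx hlt).asymm

theorem map_take (hφ : IsEmb k φ) {x : List ℕ} (hx : x ∈ tree k) (j : ℕ) :
    φ (x.take j) = (φ x).take j := by
  have ht := mem_tree_of_isPrefix hx (take_isPrefix j x)
  have h := List.prefix_iff_eq_take.1 (hφ.pre _ ht _ hx (take_isPrefix j x))
  rw [h, hφ.length _ ht, List.length_take, ← hφ.length _ hx, List.take_eq_take_iff]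
  simp

theorem pre_iff (hφ : IsEmb k φ) {x y : List ℕ} (hx : x ∈ tree k) (hy : y ∈ tree k) :
    φ x <+: φ y ↔ x <+: y := by
  refine ⟨fun h => ?_, hφ.pre x hx y hy⟩
  rw [List.prefix_iff_eq_take, hφ.length x hx, ← hφ.map_take hy] at h
  rw [hφ.injOn hx (mem_tree_of_isPrefix hy (take_isPrefix _ _)) h]
  exact take_isPrefix _ _

theorem map_nil (hφ : IsEmb k φ) : φ [] = [] :=
  List.length_eq_zero_iff.1 (hφ.length [] (nil_mem_tree k))

/-- The image of the node `⟨n⟩` is `⟨head φ n⟩`. -/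
def head (φ : List ℕ → List ℕ) (n : ℕ) : ℕ := (φ [n]).headI

theorem map_singleton (hφ : IsEmb k φ) (n : ℕ) : φ [n] = [head φ n] := by
  obtain ⟨a, ha⟩ := List.length_eq_one_iff.1 (hφ.length [n] (singleton_mem_tree k n))
  simp [head, ha]

theorem map_cons (hφ : IsEmb k φ) {n : ℕ} {y : List ℕ} (h : n :: y ∈ tree k) :
    ∃ z, φ (n :: y) = head φ n :: z := by
  obtain ⟨z, hz⟩ := hφ.pre [n] (singleton_mem_tree k n) (n :: y) h ⟨y, rfl⟩
  exact ⟨z, by rw [← hz, hφ.map_singleton]; rfl⟩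

theorem head_strictMono (hφ : IsEmb k φ) : StrictMono (head φ) := by
  intro m n h
  have := hφ.lt [m] (singleton_mem_tree k m) [n] (singleton_mem_tree k n)
    (List.cons_lt_cons_iff.2 (Or.inl h))
  rw [hφ.map_singleton, hφ.map_singleton] at this
  simpa [List.cons_lt_cons_iff] using this

/-- The block of a nonroot node is given by its first entry, and `head φ` is injective. -/
theorem image_inter_block (hφ : IsEmb k φ) (n : ℕ) :
    φ '' tree k ∩ block k (head φ n) = φ '' block k n := by
  ext z
  constructor
  · rintro ⟨⟨x, hx, rfl⟩, hz⟩
    cases x with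
    | nil => exact ⟨[], nil_mem_block _ _, rfl⟩
    | cons m y =>
      obtain ⟨w, hw⟩ := hφ.map_cons hx
      rw [hw] at hz
      obtain rfl := hφ.head_strictMono.injective (cons_mem_block.1 hz).1
      exact ⟨m :: y, cons_mem_block.2 ⟨rfl, hx⟩, rfl⟩
  · rintro ⟨x, hx, rfl⟩
    refine ⟨⟨x, block_subset_tree k n hx, rfl⟩, ?_⟩
    cases x with
    | nil => rw [hφ.map_nil]; exact nil_mem_block _ _
    | cons m y =>
      obtain ⟨rfl, h⟩ := cons_mem_block.1 hx
      obtain ⟨w, hw⟩ := hφ.map_cons h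
      rw [hw]
      exact cons_mem_block.2 ⟨rfl, hw ▸ hφ.mem _ h⟩

/-- The range of an embedding is a member of `ℛ_k`. -/
noncomputable def toRSpace (hφ : IsEmb k φ) : RSpace k where
  carrier := φ '' tree k
  idx := head φ
  subset_tree := by rintro _ ⟨x, hx, rfl⟩; exact hφ.mem x hx
  prefix_closed := by
    rintro _ ⟨x, hx, rfl⟩ y hy
    refine ⟨x.take y.length, mem_tree_of_isPrefix hx (take_isPrefix _ _), ?_⟩
    rw [hφ.map_take hx, ← List.prefix_iff_eq_take.1 hy]
  idx_strictMono := hφ.head_strictMono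
  iso n := by
    have hsub := block_subset_tree k n
    let f : block k n ≃ (φ '' tree k ∩ block k (head φ n) : Set (List ℕ)) :=
      ((hφ.injOn.mono hsub).bijOn_image.equiv φ).trans
        (Equiv.setCongr (hφ.image_inter_block n).symm)
    have hf : ∀ x, (f x : List ℕ) = φ x := fun x => rfl
    refine ⟨f.symm, fun x y => ?_, fun x y => ?_⟩
    · have := hφ.pre_iff (hsub (f.symm x).2) (hsub (f.symm y).2)
      rwa [← hf, ← hf, f.apply_symm_apply, f.apply_symm_apply] at this
    · have := hφ.lt_iff (hsub (f.symm x).2) (hsub (f.symm y).2)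
      rwa [← hf, ← hf, f.apply_symm_apply, f.apply_symm_apply] at this
  only := by
    rintro j ⟨_, ⟨⟨x, hx, rfl⟩, hj⟩, hne⟩
    cases x with
    | nil => exact absurd hφ.map_nil hne
    | cons m y =>
      obtain ⟨w, hw⟩ := hφ.map_cons hx
      rw [hw] at hj
      exact ⟨m, (cons_mem_block.1 hj).1.symm⟩

end IsEmb

/-! ## Every member of `ℛ_k` is the range of an embedding -/

/-- Adding one entry to a node makes its image strictly longer, by injectivity. Applied to a
bijection and its inverse, this shows that tree isomorphisms preserve length. -/
theorem length_le_length_of_prefix_lt {A B : Set (List ℕ)} (hA : ∀ x ∈ A, ∀ y, y <+: x → y ∈ A)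
    (f : A → B) (hf : f.Injective) (hpre : ∀ x y : A, (x : List ℕ) <+: y → (f x : List ℕ) <+: f y)
    (x : A) : (x : List ℕ).length ≤ (f x : List ℕ).length := by
  obtain ⟨x, hx⟩ := x
  induction x using List.reverseRecOn with
  | nil => simp
  | append_singleton y a ih =>
    have hy : y ∈ A := hA _ hx _ ⟨[a], rfl⟩
    have hp := hpre ⟨y, hy⟩ ⟨_, hx⟩ ⟨[a], rfl⟩
    have hne : (f ⟨y, hy⟩ : List ℕ) ≠ f ⟨y ++ [a], hx⟩ := fun h => by
      have := congrArg Subtype.val (hf (Subtype.ext h))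
      simp at this
    have hlt : (f ⟨y, hy⟩ : List ℕ).length < (f ⟨y ++ [a], hx⟩ : List ℕ).length :=
      lt_of_le_of_ne hp.length_le fun h => hne (hp.eq_of_length h)
    have := ih hy
    simp only [List.length_append, List.length_singleton] at *
    omega

theorem length_eq_of_equiv {A B : Set (List ℕ)} (hA : ∀ x ∈ A, ∀ y, y <+: x → y ∈ A)
    (hB : ∀ x ∈ B, ∀ y, y <+: x → y ∈ B) (f : A ≃ B)
    (hpre : ∀ x y : A, (x : List ℕ) <+: y ↔ (f x : List ℕ) <+: f y) (x : A) :
    (f x : List ℕ).length = (x : List ℕ).length := by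
  refine le_antisymm ?_ (length_le_length_of_prefix_lt hA f f.injective (fun x y => (hpre x y).1) x)
  have := length_le_length_of_prefix_lt hB f.symm f.symm.injective
    (fun x y h => (hpre _ _).2 (by simpa using h)) (f x)
  simpa using this

theorem RSpace.exists_isEmb {k : ℕ} (X : RSpace k) :
    ∃ φ, IsEmb k φ ∧ X.carrier = φ '' tree k ∧ X.idx = IsEmb.head φ := by
  classical
  choose f hpre hlt using X.iso
  have hA : ∀ n, ∀ x ∈ X.carrier ∩ block k (X.idx n), ∀ y, y <+: x →
      y ∈ X.carrier ∩ block k (X.idx n) := fun n x hx y hy =>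
    ⟨X.prefix_closed x hx.1 y hy, mem_block_of_isPrefix hx.2 hy⟩
  have hlen : ∀ n x, ((f n).symm x : List ℕ).length = (x : List ℕ).length := fun n x => by
    have := length_eq_of_equiv (hA n) (fun x hx y hy => mem_block_of_isPrefix hx hy) (f n) (hpre n)
      ((f n).symm x)
    simpa using this.symm
  have hpre' : ∀ n x y, (((f n).symm x : List ℕ) <+: (f n).symm y) ↔ (x : List ℕ) <+: y :=
    fun n x y => by simpa using hpre n ((f n).symm x) ((f n).symm y)
  have hlt' : ∀ n x y, (((f n).symm x : List ℕ) < (f n).symm y) ↔ (x : List ℕ) < y :=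
    fun n x y => by simpa using hlt n ((f n).symm x) ((f n).symm y)
  -- The inverse isomorphisms are glued, with the first entry choosing the block. The root goes
  -- through block `0`, as `headI [] = 0`; the default `[]` is reached only off the tree.
  let φ : List ℕ → List ℕ := fun x =>
    if h : x ∈ block k x.headI then ((f x.headI).symm ⟨x, h⟩ : List ℕ) else []
  have hcons : ∀ n y (h : n :: y ∈ block k n), φ (n :: y) = (f n).symm ⟨n :: y, h⟩ :=
    fun n y h => dif_pos h
  have hblk : ∀ {n y}, n :: y ∈ tree k → n :: y ∈ block k n := fun h => cons_mem_block.2 ⟨rfl, h⟩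
  have hmem : ∀ n y, n :: y ∈ tree k → φ (n :: y) ∈ X.carrier ∩ block k (X.idx n) :=
    fun n y h => by rw [hcons n y (hblk h)]; exact ((f n).symm _).2
  have hnil : φ [] = [] := by
    have h : [] ∈ block k ([] : List ℕ).headI := nil_mem_block _ _
    have : φ [] = (f ([] : List ℕ).headI).symm ⟨[], h⟩ := dif_pos h
    rw [this]
    exact List.length_eq_zero_iff.1 (hlen _ ⟨[], h⟩)
  have hlength : ∀ x ∈ tree k, (φ x).length = x.length := by
    intro x hx
    cases x with
    | nil => simp [hnil]
    | cons n y => rw [hcons n y (hblk hx)]; exact hlen _ _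
  have hhead : ∀ n y, n :: y ∈ tree k → ∃ z, φ (n :: y) = X.idx n :: z := by
    intro n y h
    have h1 := hmem n y h
    have h2 := hlength _ h
    cases hz : φ (n :: y) with
    | nil => simp [hz] at h2
    | cons a z =>
      rw [hz] at h1
      rw [(cons_mem_block.1 h1.2).1]
      exact ⟨z, rfl⟩
  have hnilX : [] ∈ X.carrier := by
    obtain ⟨h, -⟩ := hmem 0 [] (singleton_mem_tree k 0)
    exact X.prefix_closed _ h [] (nil_isPrefix _)
  have hmemX : ∀ x ∈ tree k, φ x ∈ X.carrier := by
    intro x hx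
    cases x with
    | nil => rwa [hnil]
    | cons n y => exact (hmem n y hx).1
  have hemb : IsEmb k φ := by
    refine ⟨fun x hx => X.subset_tree (hmemX x hx), hlength, fun x hx y hy h => ?_,
      fun x hx y hy h => ?_⟩
    · cases x with
      | nil => rw [hnil]; exact (nil_isPrefix _)
      | cons n x =>
        obtain ⟨t, rfl⟩ := h
        rw [List.cons_append] at hy ⊢
        rw [hcons n _ (hblk hx), hcons n _ (hblk hy)]
        exact (hpre' n _ _).2 ⟨t, rfl⟩
    · cases y with
      | nil => exact absurd h (List.not_lt_nil _)
      | cons m y =>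
        cases x with
        | nil =>
          obtain ⟨z, hz⟩ := hhead m y hy
          rw [hnil, hz]
          exact List.nil_lt_cons _ _
        | cons n x =>
          rcases List.cons_lt_cons_iff.1 h with hnm | ⟨rfl, h'⟩
          · obtain ⟨z, hz⟩ := hhead m y hy
            obtain ⟨w, hw⟩ := hhead n x hx
            rw [hz, hw]
            exact List.cons_lt_cons_iff.2 (Or.inl (X.idx_strictMono hnm))
          · rw [hcons n _ (hblk hx), hcons n _ (hblk hy)]
            exact (hlt' n _ _).2 h
  refine ⟨φ, hemb, Set.Subset.antisymm ?_ ?_, funext fun n => ?_⟩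
  · intro z hz
    cases z with
    | nil => exact ⟨[], nil_mem_tree k, hnil⟩
    | cons a z =>
      have hblock := cons_mem_block.2 ⟨rfl, X.subset_tree hz⟩
      obtain ⟨n, rfl⟩ := X.only a ⟨a :: z, ⟨hz, hblock⟩, by simp⟩
      have hl := hlen n (f n ⟨_, hz, hblock⟩)
      rw [Equiv.symm_apply_apply] at hl
      have hx := (f n ⟨_, hz, hblock⟩).2
      cases hxe : (f n ⟨_, hz, hblock⟩ : List ℕ) with
      | nil => rw [hxe] at hl; simp at hl
      | cons b x =>
        rw [hxe] at hx
        obtain ⟨rfl, hx'⟩ := cons_mem_block.1 hx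
        refine ⟨b :: x, hx', ?_⟩
        rw [hcons b x hx]
        have : (⟨b :: x, hx⟩ : block k b) = f b ⟨_, hz, hblock⟩ := Subtype.ext hxe.symm
        rw [this, Equiv.symm_apply_apply]
  · rintro _ ⟨x, hx, rfl⟩
    exact hmemX x hx
  · obtain ⟨z, hz⟩ := hhead n [] (singleton_mem_tree k n)
    simp [IsEmb.head, hz]

/-- The embedding with range `X`. -/
noncomputable def RSpace.emb {k : ℕ} (X : RSpace k) : List ℕ → List ℕ := X.exists_isEmb.choose

theorem RSpace.isEmb_emb {k : ℕ} (X : RSpace k) : IsEmb k X.emb := X.exists_isEmb.choose_spec.1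

theorem RSpace.carrier_eq {k : ℕ} (X : RSpace k) : X.carrier = X.emb '' tree k :=
  X.exists_isEmb.choose_spec.2.1

theorem RSpace.idx_eq {k : ℕ} (X : RSpace k) : X.idx = IsEmb.head X.emb :=
  X.exists_isEmb.choose_spec.2.2

theorem RSpace.sub_eq {k : ℕ} (X : RSpace k) (n : ℕ) : X.sub n = X.emb '' block k n := by
  rw [RSpace.sub, X.carrier_eq, X.idx_eq, X.isEmb_emb.image_inter_block]

theorem RSpace.emb_mem {k : ℕ} (X : RSpace k) {x : List ℕ} (hx : x ∈ tree k) :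
    X.emb x ∈ X.carrier := by rw [X.carrier_eq]; exact ⟨x, hx, rfl⟩

/-- Inclusion already yields the sequence of blocks: `only` finds each index of `Y` among the
indices of `X`, and both index sequences are strictly increasing. -/
theorem RSpace.red_iff {k : ℕ} {Y X : RSpace k} : Y.Red X ↔ Y.carrier ⊆ X.carrier := by
  constructor
  · rintro ⟨l, -, h⟩
    rw [Y.carrier_eq]
    rintro _ ⟨x, hx, rfl⟩
    obtain ⟨n, hn⟩ := Set.mem_iUnion.1 hx
    have : Y.emb x ∈ Y.sub n := by rw [Y.sub_eq]; exact ⟨x, hn, rfl⟩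
    exact (h n this).1
  · intro h
    have : ∀ n, ∃ m, Y.idx n = X.idx m := fun n => by
      have h1 := h (Y.emb_mem (singleton_mem_tree k n))
      rw [Y.isEmb_emb.map_singleton, ← Y.idx_eq] at h1
      exact X.only _ ⟨_, ⟨h1, cons_mem_block.2 ⟨rfl, singleton_mem_tree _ _⟩⟩, by simp⟩
    choose l hl using this
    refine ⟨l, fun a b hab => ?_, fun n x hx => ⟨h hx.1, ?_⟩⟩
    · rw [← X.idx_strictMono.lt_iff_lt, ← hl, ← hl]
      exact Y.idx_strictMono hab
    · rw [← hl]; exact hx.2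

/-! ## Postorder numbering of the nodes -/

/-- The number of nonroot nodes of `𝕋_k(0) ∪ … ∪ 𝕋_k(n - 1)`. -/
def nodesBelow : ℕ → ℕ → ℕ
  | 0, n => n
  | k + 1, n => ∑ m ∈ Finset.range n, (1 + nodesBelow k (m + 1))

theorem nodesBelow_strictMono (k : ℕ) : StrictMono (nodesBelow k) := by
  cases k with
  | zero => exact strictMono_id
  | succ k =>
    refine strictMono_nat_of_lt_succ fun n => ?_
    simp only [nodesBelow, Finset.sum_range_succ]
    omega

/-- The position of a nonroot node in the postorder enumeration of `𝕋_k`. -/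
def post : ℕ → List ℕ → ℕ
  | _, [] => 0
  | 0, n :: _ => n
  | k + 1, n :: y => nodesBelow (k + 1) n + if y = [] then nodesBelow k (n + 1) else post k y

theorem nodesBelow_le_post {k n : ℕ} {y : List ℕ} : nodesBelow k n ≤ post k (n :: y) := by
  cases k <;> simp [post, nodesBelow]

theorem tail_mem_tree {k n : ℕ} {y : List ℕ} (h : n :: y ∈ tree (k + 1)) : y ∈ tree k := by
  rw [mem_tree_iff] at *
  exact ⟨by simpa using h.1, (List.pairwise_cons.1 h.2).2⟩

theorem le_of_cons_cons_mem_tree {k n m : ℕ} {y : List ℕ} (h : n :: m :: y ∈ tree k) : m ≤ n :=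
  (List.pairwise_cons.1 (mem_tree_iff.1 h).2).1 m (by simp)

/-- With `nodesBelow_le_post`, this confines the numbers of the nodes with first entry `n` to the
interval from `nodesBelow k n` to `nodesBelow k (n + 1)`. -/
theorem post_lt_nodesBelow {k n : ℕ} {y : List ℕ} (h : n :: y ∈ tree k) :
    post k (n :: y) < nodesBelow k (n + 1) := by
  induction k generalizing n y with
  | zero => simp [post, nodesBelow]
  | succ k ih =>
    have hs : nodesBelow (k + 1) (n + 1) = nodesBelow (k + 1) n + (1 + nodesBelow k (n + 1)) := by
      simp [nodesBelow, Finset.sum_range_succ]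
    rw [hs]
    cases y with
    | nil => simp [post]
    | cons m y =>
      have h1 := ih (tail_mem_tree h)
      have h2 := (nodesBelow_strictMono k).monotone
        (Nat.add_le_add_right (le_of_cons_cons_mem_tree h) 1)
      simp only [post, reduceCtorEq, if_false]
      omega

/-- Past the common part `p`, the two nodes lie in disjoint intervals of the enumeration, ordered as
`a` and `b`. -/
theorem post_append_lt {k a b : ℕ} {p s t : List ℕ} (hab : a < b) (hx : p ++ a :: s ∈ tree k)
    (hy : p ++ b :: t ∈ tree k) : post k (p ++ a :: s) < post k (p ++ b :: t) := by
  induction p generalizing k with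
  | nil =>
    exact (post_lt_nodesBelow hx).trans_le
      (((nodesBelow_strictMono k).monotone hab).trans nodesBelow_le_post)
  | cons c p ih =>
    cases k with
    | zero => simp [mem_tree_iff] at hx
    | succ k =>
      have := ih (tail_mem_tree hx) (tail_mem_tree hy)
      simpa [post] using this

/-- Postorder lists descendants before ancestors. The root is excluded because its number `0` is a
dummy value. -/
theorem post_lt_of_isPrefix {k : ℕ} {x y : List ℕ} (hx : x ∈ tree k) (hy : y ≠ []) (h : y <+: x)
    (hne : y.length < x.length) : post k x < post k y := by
  induction y generalizing k x with
  | nil => exact absurd rfl hy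
  | cons n y ih =>
    obtain ⟨t, rfl⟩ := h
    cases k with
    | zero =>
      have := (mem_tree_iff.1 hx).1
      rw [List.length_append, List.length_cons] at *
      omega
    | succ k =>
      rw [List.cons_append] at *
      cases y with
      | nil =>
        cases t with
        | nil => simp at hne
        | cons m t =>
          have h1 := post_lt_nodesBelow (tail_mem_tree hx)
          have h2 := (nodesBelow_strictMono k).monotone
            (Nat.add_le_add_right (le_of_cons_cons_mem_tree hx) 1)
          simp only [post, List.nil_append, reduceCtorEq, if_false, if_true] at *
          omega
      | cons m y =>
        have := ih (tail_mem_tree hx) (by simp) ⟨t, rfl⟩ (by simpa using hne)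
        simpa [post] using this

/-! ## Leaves -/

/-- The maximal nodes of `𝕋_k`. -/
def leaves (k : ℕ) : Set (List ℕ) := {x | x ∈ tree k ∧ x.length = k + 1}

theorem take_mem_tree {k : ℕ} {x : List ℕ} (hx : x ∈ tree k) (j : ℕ) : x.take j ∈ tree k :=
  mem_tree_of_isPrefix hx (take_isPrefix j x)

theorem take_le_take {x y : List ℕ} (h : x ≤ y) (j : ℕ) : x.take j ≤ y.take j := by
  rcases h.eq_or_lt with rfl | h
  · exact le_rfl
  rcases prefix_or_exists_of_lt h with hp | ⟨p, a, b, s, t, rfl, rfl, hab⟩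
  · by_cases heq : x.take j = y.take j
    · exact heq.le
    · exact (lt_of_prefix_of_ne (hp.take j) heq).le
  · rw [List.take_append, List.take_append]
    cases hj : j - p.length with
    | zero => simp
    | succ i =>
      rw [List.take_of_length_le (by omega : p.length ≤ j)]
      exact (append_lt_append_of_lt hab).le

theorem post_take_lt_iff_same {k : ℕ} {u : List ℕ} (hu : u ∈ leaves k) {i j : ℕ} (hi : i < k + 1)
    (hj : j < k + 1) : post k (u.take (i + 1)) < post k (u.take (j + 1)) ↔ j < i := by
  have key : ∀ {i j : ℕ}, i < k + 1 → j < i →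
      post k (u.take (i + 1)) < post k (u.take (j + 1)) := by
    intro i j hi hij
    have h2 := hu.2
    refine post_lt_of_isPrefix (take_mem_tree hu.1 _) ?_ (List.take_prefix_take_left (by omega)) ?_
    · rw [← List.length_pos_iff, List.length_take]; omega
    · rw [List.length_take, List.length_take]; omega
  refine ⟨fun h => ?_, key hi⟩
  by_contra! hle
  rcases hle.eq_or_lt with rfl | hlt
  · exact lt_irrefl _ h
  · exact (key hj hlt).asymm h

theorem post_take_lt_of_take_ne {k : ℕ} {u v : List ℕ} (hu : u ∈ leaves k) (hv : v ∈ leaves k)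
    (huv : u < v) {i j : ℕ}
    (hne : u.take (min i j + 1) ≠ v.take (min i j + 1)) :
    post k (u.take (i + 1)) < post k (v.take (j + 1)) := by
  rcases prefix_or_exists_of_lt huv with h | ⟨p, a, b, s, t, rfl, rfl, hab⟩
  · exact absurd (h.eq_of_length (hu.2.trans hv.2.symm)) huv.ne
  · have hp : p.length ≤ min i j := by
      by_contra! hlt
      exact hne (by rw [List.take_append_of_le_length hlt, List.take_append_of_le_length hlt])
    have htake : ∀ (c : ℕ) (w : List ℕ) {l : ℕ}, min i j ≤ l →
        (p ++ c :: w).take (l + 1) = p ++ c :: w.take (l - p.length) := by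
      intro c w l hl
      rw [List.take_append, List.take_of_length_le (by omega),
        show l + 1 - p.length = (l - p.length) + 1 by omega, List.take_succ_cons]
    have hu' := take_mem_tree hu.1 (i + 1)
    have hv' := take_mem_tree hv.1 (j + 1)
    rw [htake a s (min_le_left i j)] at hu' ⊢
    rw [htake b t (min_le_right i j)] at hv' ⊢
    exact post_append_lt hab hu' hv'

theorem take_eq_take_of_le {u v : List ℕ} {i j : ℕ} (h : u.take j = v.take j) (hij : i ≤ j) :
    u.take i = v.take i := by
  have := congrArg (List.take i) h
  rwa [List.take_take, List.take_take, min_eq_left hij] at this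

/-- If the two branches have separated by the shallower level, the lexicographic order decides;
otherwise both nodes lie on one branch and the deeper one comes first. Beyond `u < v`, only
equalities of restrictions matter. -/
theorem post_take_lt_iff {k : ℕ} {u v : List ℕ} (hu : u ∈ leaves k) (hv : v ∈ leaves k)
    (huv : u < v) {i j : ℕ} (hi : i < k + 1) (hj : j < k + 1) :
    post k (u.take (i + 1)) < post k (v.take (j + 1)) ↔
      u.take (min i j + 1) ≠ v.take (min i j + 1) ∨ j < i := by
  by_cases hne : u.take (min i j + 1) = v.take (min i j + 1)
  · simp only [hne, ne_eq, not_true_eq_false, false_or]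
    rcases le_total i j with hij | hij
    · rw [min_eq_left hij] at hne
      rw [hne, post_take_lt_iff_same hv hi hj]
    · rw [min_eq_right hij] at hne
      rw [← hne, post_take_lt_iff_same hu hi hj]
  · simp only [ne_eq, hne, not_false_eq_true, true_or, iff_true]
    exact post_take_lt_of_take_ne hu hv huv hne

theorem post_take_gt_iff {k : ℕ} {u v : List ℕ} (hu : u ∈ leaves k) (hv : v ∈ leaves k)
    (huv : u < v) {i j : ℕ} (hi : i < k + 1) (hj : j < k + 1) :
    post k (v.take (j + 1)) < post k (u.take (i + 1)) ↔
      u.take (min i j + 1) = v.take (min i j + 1) ∧ i < j := by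
  by_cases hne : u.take (min i j + 1) = v.take (min i j + 1)
  · simp only [hne, true_and]
    rcases le_total i j with hij | hij
    · rw [min_eq_left hij] at hne
      rw [hne, post_take_lt_iff_same hv hj hi]
    · rw [min_eq_right hij] at hne
      rw [← hne, post_take_lt_iff_same hu hj hi]
  · simp only [hne, false_and, iff_false]
    exact (post_take_lt_of_take_ne hu hv huv hne).asymm

/-! ## Canonical colourings of tuples of leaves -/

/-- The embedding of `𝕋_k` that relabels the nodes by the values of `H` at their postorder
numbers. -/
def postMap (k : ℕ) (H : ℕ → ℕ) (x : List ℕ) : List ℕ :=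
  List.ofFn fun j : Fin x.length => H (post k (x.take (j + 1)))

theorem postMap_append_singleton (k : ℕ) (H : ℕ → ℕ) (x : List ℕ) (a : ℕ) :
    postMap k H (x ++ [a]) = postMap k H x ++ [H (post k (x ++ [a]))] := by
  refine List.ext_getElem (by simp [postMap]) fun i h1 h2 => ?_
  simp only [postMap, List.length_ofFn, List.length_append, List.length_singleton] at h1
  rcases Nat.lt_succ_iff_lt_or_eq.1 h1 with h | rfl
  · rw [List.getElem_append_left (by simpa [postMap] using h)]
    simp only [postMap, List.getElem_ofFn]
    rw [List.take_append_of_le_length (by omega)]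
  · rw [List.getElem_append_right (by simp [postMap])]
    simp only [postMap, List.getElem_ofFn, List.length_ofFn, Nat.sub_self, List.getElem_cons_zero]
    rw [List.take_of_length_le (by simp)]

theorem postMap_isPrefix (k : ℕ) (H : ℕ → ℕ) (x t : List ℕ) :
    postMap k H x <+: postMap k H (x ++ t) := by
  induction t generalizing x with
  | nil => simp
  | cons a t ih =>
    have h := ih (x ++ [a])
    rw [postMap_append_singleton, List.append_assoc] at h
    exact (List.prefix_append _ _).trans h

/-- Numbers decrease along branches, so the new labels are nonincreasing as `tree k` demands; they
increase from sibling to sibling, which preserves the lexicographic order. -/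
theorem isEmb_postMap (k : ℕ) {H : ℕ → ℕ} (hH : StrictMono H) : IsEmb k (postMap k H) where
  mem x hx := by
    refine mem_tree_iff.2 ⟨by simpa [postMap] using (mem_tree_iff.1 hx).1, ?_⟩
    refine List.pairwise_ofFn.2 fun i j hij => hH.monotone (le_of_lt ?_)
    refine post_lt_of_isPrefix (take_mem_tree hx _) ?_ (List.take_prefix_take_left (by omega)) ?_
    · rw [← List.length_pos_iff, List.length_take]; omega
    · rw [List.length_take, List.length_take]; omega
  length x _ := by simp [postMap]
  pre x _ y _ h := by
    obtain ⟨t, rfl⟩ := h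
    exact postMap_isPrefix k H x t
  lt x hx y hy h := by
    rcases prefix_or_exists_of_lt h with h' | ⟨p, a, b, s, t, rfl, rfl, hab⟩
    · obtain ⟨t, rfl⟩ := h'
      refine lt_of_prefix_of_ne (postMap_isPrefix k H x t) fun heq => h.ne ?_
      have := congrArg List.length heq
      simp only [postMap, List.length_ofFn, List.length_append] at this
      rw [List.length_eq_zero_iff.1 (by omega : t.length = 0), List.append_nil]
    · have hexp : ∀ c w, ∃ r, postMap k H (p ++ c :: w) =
          postMap k H p ++ H (post k (p ++ [c])) :: r := fun c w => by
        obtain ⟨r, hr⟩ := postMap_isPrefix k H (p ++ [c]) w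
        refine ⟨r, ?_⟩
        rw [postMap_append_singleton] at hr
        simpa using hr.symm
      obtain ⟨r, hr⟩ := hexp a s
      obtain ⟨q, hq⟩ := hexp b t
      rw [hr, hq]
      refine append_lt_append_of_lt (hH (post_append_lt hab ?_ ?_))
      · exact mem_tree_of_isPrefix hx ⟨s, by simp⟩
      · exact mem_tree_of_isPrefix hy ⟨t, by simp⟩

/-- Every finite colouring of tuples of leaves depends, after passing to the range of an embedding,
only on the equalities between the restrictions of the leaves. -/
theorem leaf_ramsey (k n : ℕ) {κ : Type*} [Finite κ] (C : (Fin n → List ℕ) → κ) :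
    ∃ φ, IsEmb k φ ∧ ∀ t t' : Fin n → List ℕ, (∀ i, t i ∈ leaves k) → (∀ i, t' i ∈ leaves k) →
      StrictMono t → StrictMono t' →
      (∀ a i j, (t i).take a = (t j).take a ↔ (t' i).take a = (t' j).take a) →
      C (φ ∘ t) = C (φ ∘ t') := by
  -- Row `i` of the array `L` is read as the `i`-th leaf, its entries being the labels at levels `1`
  -- to `k + 1`.
  obtain ⟨H, hH, hC⟩ := orderType_ramsey fun L : Fin n × Fin (k + 1) → ℕ =>
    C fun i => List.ofFn fun j => L (i, j)
  refine ⟨postMap k H, isEmb_postMap k hH, fun t t' ht ht' hmono hmono' heq => ?_⟩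
  have hdec : ∀ s : Fin n → List ℕ, (∀ i, s i ∈ leaves k) → postMap k H ∘ s =
      fun i => List.ofFn fun j : Fin (k + 1) => H (post k ((s i).take (j + 1))) := by
    intro s hs
    funext i
    exact List.ext_getElem (by simp [postMap, (hs i).2]) fun j h1 h2 => by
      simp [postMap, -List.ofFn_succ]
  rw [hdec t ht, hdec t' ht']
  refine hC (fun q => post k ((t q.1).take (q.2 + 1))) (fun q => post k ((t' q.1).take (q.2 + 1)))
    ?_
  rintro ⟨i, a⟩ ⟨j, b⟩
  rcases lt_trichotomy i j with hij | rfl | hij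
  · simp only
    rw [post_take_lt_iff (ht i) (ht j) (hmono hij) a.2 b.2,
      post_take_lt_iff (ht' i) (ht' j) (hmono' hij) a.2 b.2, ne_eq, ne_eq, heq]
  · simp only
    rw [post_take_lt_iff_same (ht i) a.2 b.2, post_take_lt_iff_same (ht' i) a.2 b.2]
  · simp only
    rw [post_take_gt_iff (ht j) (ht i) (hmono hij) b.2 a.2,
      post_take_gt_iff (ht' j) (ht' i) (hmono' hij) b.2 a.2, heq]

/-! ## Meets and types -/

/-- The length of the longest common initial segment of two leaves, cut off at `k`. -/
def meet (k : ℕ) (x y : List ℕ) : ℕ := Nat.findGreatest (fun j => x.take j = y.take j) k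

theorem le_meet_iff {k j : ℕ} {x y : List ℕ} (hj : j ≤ k) :
    j ≤ meet k x y ↔ x.take j = y.take j := by
  constructor
  · intro h
    have : x.take (meet k x y) = y.take (meet k x y) :=
      Nat.findGreatest_spec (P := fun j => x.take j = y.take j) (Nat.zero_le k) (by simp)
    exact take_eq_take_of_le this h
  · exact fun h => Nat.le_findGreatest hj h

/-- The meets of the consecutive members of a sequence of leaves. -/
def meetType (k : ℕ) {n : ℕ} (t : Fin n → List ℕ) (i : Fin (n - 1)) : Fin (k + 1) :=
  ⟨meet k (t ⟨i, by omega⟩) (t ⟨i + 1, by omega⟩), Nat.lt_succ_iff.2 (Nat.findGreatest_le k)⟩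

/-- Truncation is monotone, so if the truncations at `i` and `j` agree, all those in between agree
too. This reduces the claim to consecutive leaves, which the type controls. -/
theorem take_eq_of_meetType_eq {k n : ℕ} {t t' : Fin n → List ℕ} (ht : Monotone t)
    (h : meetType k t = meetType k t') {a : ℕ} (ha : a ≤ k) {i j : ℕ} (hij : i ≤ j) (hj : j < n)
    (hta : (t ⟨i, hij.trans_lt hj⟩).take a = (t ⟨j, hj⟩).take a) :
    (t' ⟨i, hij.trans_lt hj⟩).take a = (t' ⟨j, hj⟩).take a := by
  induction j, hij using Nat.le_induction with
  | base => rfl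
  | succ j hij ih =>
    have h1 := take_le_take (ht (show (⟨i, by omega⟩ : Fin n) ≤ ⟨j, by omega⟩ from hij)) a
    have h2 := take_le_take (ht (show (⟨j, by omega⟩ : Fin n) ≤ ⟨j + 1, hj⟩ from
      Nat.le_succ j)) a
    have h3 : (t ⟨i, by omega⟩).take a = (t ⟨j, by omega⟩).take a :=
      le_antisymm h1 (h2.trans_eq hta.symm)
    refine (ih (by omega) h3).trans ?_
    have h4 := congrArg Fin.val (congrFun h ⟨j, by omega⟩)
    simp only [meetType] at h4
    rw [← le_meet_iff ha, ← h4, le_meet_iff ha]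
    exact h3.symm.trans hta

theorem take_eq_iff_of_meetType_eq {k n : ℕ} {t t' : Fin n → List ℕ} (ht : ∀ i, t i ∈ leaves k)
    (ht' : ∀ i, t' i ∈ leaves k) (hm : StrictMono t) (hm' : StrictMono t')
    (h : meetType k t = meetType k t') (a : ℕ) (i j : Fin n) :
    (t i).take a = (t j).take a ↔ (t' i).take a = (t' j).take a := by
  by_cases ha : a ≤ k
  · rcases le_total i j with hij | hij
    · exact ⟨take_eq_of_meetType_eq hm.monotone h ha hij j.2,
        take_eq_of_meetType_eq hm'.monotone h.symm ha hij j.2⟩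
    · exact ⟨fun e => (take_eq_of_meetType_eq hm.monotone h ha hij i.2 e.symm).symm,
        fun e => (take_eq_of_meetType_eq hm'.monotone h.symm ha hij i.2 e.symm).symm⟩
  -- Truncating beyond `k` leaves a leaf unchanged, so the equivalence is that of `i = j` with
  -- itself.
  · have hlen : ∀ {x}, x ∈ leaves k → x.take a = x := fun hx =>
      List.take_of_length_le (by rw [hx.2]; omega)
    rw [hlen (ht i), hlen (ht j), hlen (ht' i), hlen (ht' j), hm.injective.eq_iff,
      hm'.injective.eq_iff]

theorem IsEmb.meet_map {k : ℕ} {φ : List ℕ → List ℕ} (hφ : IsEmb k φ) {x y : List ℕ}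
    (hx : x ∈ tree k) (hy : y ∈ tree k) : meet k (φ x) (φ y) = meet k x y := by
  unfold meet
  congr 1
  funext j
  rw [← hφ.map_take hx, ← hφ.map_take hy, hφ.injOn.eq_iff (take_mem_tree hx _) (take_mem_tree hy _)]

theorem IsEmb.meetType_comp {k n : ℕ} {φ : List ℕ → List ℕ} (hφ : IsEmb k φ) {t : Fin n → List ℕ}
    (ht : ∀ i, t i ∈ tree k) : meetType k (φ ∘ t) = meetType k t :=
  funext fun _ => Fin.ext (hφ.meet_map (ht _) (ht _))

/-- Every sequence of meets is realised by a sequence of leaves. -/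
theorem exists_leaves_meetType (k n : ℕ) (τ : Fin (n - 1) → Fin (k + 1)) :
    ∃ t : Fin n → List ℕ, (∀ i, t i ∈ leaves k) ∧ StrictMono t ∧ meetType k t = τ := by
  classical
  -- Passing from leaf `l` to leaf `l + 1` raises by one exactly the entries at positions `j ≥ τ l`,
  -- so the first change is at `τ l`. The summand `(k - j) * n` keeps each leaf nonincreasing, since
  -- `cnt` is at most `n - 1`.
  let cnt : ℕ → ℕ → ℕ := fun i j =>
    (Finset.univ.filter fun l : Fin (n - 1) => (l : ℕ) < i ∧ (τ l : ℕ) ≤ j).card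
  let s : ℕ → List ℕ := fun i => List.ofFn fun j : Fin (k + 1) => (k - j) * n + cnt i j
  have hcnt : ∀ i j, cnt i j ≤ n - 1 := fun i j =>
    (Finset.card_le_univ _).trans_eq (Fintype.card_fin _)
  have hleaf : ∀ i, s i ∈ leaves k := by
    intro i
    refine ⟨mem_tree_iff.2 ⟨by simp [s], List.pairwise_ofFn.2 fun a b hab => ?_⟩, by simp [s]⟩
    have h1 := hcnt i b
    have h2 : (a : ℕ) < b := hab
    have h3 : (k - b + 1) * n ≤ (k - a) * n := Nat.mul_le_mul_right n (by omega)
    rw [Nat.add_mul, one_mul] at h3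
    simp only [ge_iff_le]
    omega
  have hcs : ∀ (l : Fin (n - 1)) (j : ℕ), cnt (l + 1) j = cnt l j + if (τ l : ℕ) ≤ j then 1 else 0 := by
    intro l j
    by_cases hj : (τ l : ℕ) ≤ j
    · rw [if_pos hj, ← Finset.card_insert_of_notMem (a := l) (by simp)]
      refine congrArg Finset.card ?_
      ext m
      simp only [Finset.mem_filter, Finset.mem_univ, true_and, Finset.mem_insert, Fin.ext_iff]
      constructor
      · rintro ⟨h1, h2⟩
        by_cases hml : (m : ℕ) = l
        · exact Or.inl hml
        · exact Or.inr ⟨by omega, h2⟩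
      · rintro (h | ⟨h1, h2⟩)
        · obtain rfl := Fin.ext h
          exact ⟨by omega, hj⟩
        · exact ⟨by omega, h2⟩
    · rw [if_neg hj, add_zero]
      refine congrArg Finset.card ?_
      ext m
      simp only [Finset.mem_filter, Finset.mem_univ, true_and]
      constructor
      · rintro ⟨h1, h2⟩
        refine ⟨?_, h2⟩
        by_contra hml
        obtain rfl : m = l := Fin.ext (by omega)
        exact hj h2
      · rintro ⟨h1, h2⟩
        exact ⟨by omega, h2⟩
  have hlen : ∀ i, (s i).length = k + 1 := fun i => (hleaf i).2
  have hget : ∀ i j, j < k + 1 → (s i)[j]? = some ((k - j) * n + cnt i j) := fun i j hj => by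
    simp [s, -List.ofFn_succ, hj]
  clear_value s cnt
  have hτ : ∀ l : Fin (n - 1), (s l)[(τ l : ℕ)]? ≠ (s (l + 1))[(τ l : ℕ)]? := fun l h => by
    rw [hget _ _ (τ l).2, hget _ _ (τ l).2, hcs, if_pos le_rfl] at h
    simp at h
  have htake : ∀ (l : Fin (n - 1)) (j : ℕ), j ≤ k →
      ((s l).take j = (s (l + 1)).take j ↔ j ≤ τ l) := by
    intro l j hjk
    constructor
    · intro h
      by_contra! hlt
      refine hτ l ?_
      have := congrArg (fun x => x[(τ l : ℕ)]?) h
      simpa [List.getElem?_take, hlt] using this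
    · intro h
      refine List.ext_getElem? fun i => ?_
      rw [List.getElem?_take, List.getElem?_take]
      split_ifs with hi
      · rw [hget _ _ (by omega), hget _ _ (by omega), hcs, if_neg (by omega), add_zero]
      · rfl
  have hlt : ∀ l : Fin (n - 1), s l < s (l + 1) := by
    intro l
    have hne : s l ≠ s (l + 1) := fun h => hτ l (by rw [← h])
    rcases lt_or_gt_of_ne hne with h | h
    · exact h
    · rcases prefix_or_exists_of_lt h with h' | ⟨p, a, b, u, w, hu, hw, hab⟩
      · exact absurd (h'.eq_of_length (by rw [hlen, hlen])).symm hne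
      · have h1 : (s (l + 1))[p.length]? = some a := by rw [hu]; simp
        have h2 : (s l)[p.length]? = some b := by rw [hw]; simp
        by_cases hp : p.length < k + 1
        · rw [hget _ _ hp, Option.some.injEq] at h1 h2
          rw [hcs] at h1
          omega
        · rw [List.getElem?_eq_none (by rw [hlen]; omega)] at h1
          cases h1
  refine ⟨fun i => s i, fun i => hleaf i, ?_, ?_⟩
  · have : ∀ d i : ℕ, i + d + 1 < n → s i < s (i + d + 1) := by
      intro d
      induction d with
      | zero => exact fun i hi => hlt ⟨i, by omega⟩
      | succ d ih =>
        intro i hi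
        exact (ih i (by omega)).trans (hlt ⟨i + d + 1, by omega⟩)
    intro i j hij
    have hij' : (i : ℕ) < j := hij
    have := this (j - i - 1) i (by omega)
    rwa [show (i : ℕ) + (j - i - 1) + 1 = j by omega] at this
  · funext l
    refine Fin.ext ?_
    have hl : (τ l : ℕ) ≤ k := Nat.lt_succ_iff.1 (τ l).2
    have hm : meet k (s l) (s (l + 1)) ≤ k := Nat.findGreatest_le k
    exact le_antisymm ((htake l _ hm).1 ((le_meet_iff hm).1 le_rfl))
      ((le_meet_iff hl).2 ((htake l _ hl).2 le_rfl))

/-! ## Constructions of members of `ℛ_k` -/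

/-- Nodes of different blocks are compared by their first entries, so only pairs within one block
need checking. -/
theorem isEmb_of_blocks {k : ℕ} {φ : List ℕ → List ℕ} {h : ℕ → ℕ} (hh : StrictMono h)
    (hnil : φ [] = [])
    (hcons : ∀ n y, n :: y ∈ tree k →
      φ (n :: y) ∈ tree k ∧ (φ (n :: y)).length = y.length + 1 ∧ ∃ z, φ (n :: y) = h n :: z)
    (hpre : ∀ n x y, n :: x ∈ tree k → n :: y ∈ tree k → x <+: y → φ (n :: x) <+: φ (n :: y))
    (hlt : ∀ n x y, n :: x ∈ tree k → n :: y ∈ tree k → x < y → φ (n :: x) < φ (n :: y)) :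
    IsEmb k φ := by
  refine ⟨fun x hx => ?_, fun x hx => ?_, fun x hx y hy hxy => ?_, fun x hx y hy hxy => ?_⟩
  · cases x with
    | nil => rwa [hnil]
    | cons n x => exact (hcons n x hx).1
  · cases x with
    | nil => rw [hnil]
    | cons n x => exact (hcons n x hx).2.1
  · cases x with
    | nil => rw [hnil]; exact (nil_isPrefix _)
    | cons n x =>
      cases y with
      | nil => simp at hxy
      | cons m y =>
        obtain ⟨rfl, hxy'⟩ := List.cons_prefix_cons.1 hxy
        exact hpre _ _ _ hx hy hxy'
  · cases y with
    | nil => exact absurd hxy (List.not_lt_nil _)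
    | cons m y =>
      obtain ⟨-, -, z, hz⟩ := hcons m y hy
      cases x with
      | nil => rw [hnil, hz]; exact List.nil_lt_cons _ _
      | cons n x =>
        rcases List.cons_lt_cons_iff.1 hxy with hnm | ⟨rfl, hxy'⟩
        · obtain ⟨-, -, w, hw⟩ := hcons n x hx
          rw [hz, hw]
          exact List.cons_lt_cons_iff.2 (Or.inl (hh hnm))
        · exact hlt _ _ _ hx hy hxy'

/-- The map sending the `n`-th block into the `m n`-th block and then to its image under `φ n`. -/
def glue (φ : ℕ → List ℕ → List ℕ) (m : ℕ → ℕ) : List ℕ → List ℕ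
  | [] => []
  | n :: y => φ n (m n :: y)

/-- Since `n ≤ m n`, raising the first entry from `n` to `m n` keeps a node in the tree; this lets
blocks be drawn from different members of `ℛ_k`. -/
theorem isEmb_glue {k : ℕ} {φ : ℕ → List ℕ → List ℕ} {m : ℕ → ℕ} (hφ : ∀ n, IsEmb k (φ n))
    (hm : ∀ n, n ≤ m n) (hs : StrictMono fun n => IsEmb.head (φ n) (m n)) :
    IsEmb k (glue φ m) := by
  have hup : ∀ {n y}, n :: y ∈ tree k → m n :: y ∈ tree k := fun h =>
    cons_mem_tree_of_le h (hm _)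
  refine isEmb_of_blocks hs rfl (fun n y h => ⟨(hφ n).mem _ (hup h), (hφ n).length _ (hup h),
    (hφ n).map_cons (hup h)⟩) (fun n x y hx hy hxy => ?_) (fun n x y hx hy hxy => ?_)
  · exact (hφ n).pre _ (hup hx) _ (hup hy) (List.cons_prefix_cons.2 ⟨rfl, hxy⟩)
  · exact (hφ n).lt _ (hup hx) _ (hup hy) (List.cons_lt_cons_iff.2 (Or.inr ⟨rfl, hxy⟩))

/-- The map sending the `0`-th block to the initial segments of `v`, and shifting the others. -/
def startAt (v : List ℕ) : List ℕ → List ℕ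
  | [] => []
  | 0 :: y => v.take (y.length + 1)
  | (n + 1) :: y => (n + 1 + v.headI) :: y

theorem mem_tree_zero_iff {k : ℕ} {y : List ℕ} (h : 0 :: y ∈ tree k) : ∀ b ∈ y, b = 0 :=
  fun b hb => Nat.le_zero.1 ((List.pairwise_cons.1 (mem_tree_iff.1 h).2).1 b hb)

/-- Block `0` is a chain, so it can be sent onto the initial segments of any leaf; the shift puts
all later blocks beyond that leaf. This makes every leaf of a member available as a first
approximation. -/
theorem isEmb_startAt {k : ℕ} {v : List ℕ} (hv : v ∈ leaves k) : IsEmb k (startAt v) := by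
  obtain ⟨a, w, rfl⟩ : ∃ a w, v = a :: w := by
    cases v with
    | nil => simp [leaves] at hv
    | cons a w => exact ⟨a, w, rfl⟩
  have hlen : w.length = k := by simpa using hv.2
  refine isEmb_of_blocks (h := fun n => n + a) (fun i j hij => Nat.add_lt_add_right hij a) rfl
    (fun n y h => ?_) (fun n x y hx hy hxy => ?_) (fun n x y hx hy hxy => ?_)
  · cases n with
    | zero =>
      have hy : y.length ≤ k := by simpa using (mem_tree_iff.1 h).1
      exact ⟨take_mem_tree hv.1 _, by simp [startAt, hlen, hy], w.take y.length, by simp [startAt]⟩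
    | succ n => exact ⟨cons_mem_tree_of_le h (Nat.le_add_right _ _), rfl, y, rfl⟩
  · cases n with
    | zero => exact List.take_prefix_take_left (Nat.succ_le_succ hxy.length_le)
    | succ n => exact List.cons_prefix_cons.2 ⟨rfl, hxy⟩
  · cases n with
    | zero =>
      have hyl : y.length ≤ k := by simpa using (mem_tree_iff.1 hy).1
      have hx0 := List.eq_replicate_of_mem (mem_tree_zero_iff hx)
      have hy0 := List.eq_replicate_of_mem (mem_tree_zero_iff hy)
      have hl : x.length < y.length := by
        by_contra! hle
        have hp : y <+: x := by
          rw [hx0, hy0]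
          exact ⟨List.replicate (x.length - y.length) 0, by
            rw [List.replicate_append_replicate]; congr 1; omega⟩
        rcases eq_or_ne y x with rfl | hne
        · exact lt_irrefl _ hxy
        · exact hxy.asymm (lt_of_prefix_of_ne hp hne)
      refine lt_of_prefix_of_ne (List.take_prefix_take_left (by omega)) fun h => ?_
      have := congrArg List.length h
      simp only [startAt, List.length_take, List.length_cons] at this
      omega
    | succ n => exact List.cons_lt_cons_iff.2 (Or.inr ⟨rfl, hxy⟩)

namespace RSpace

variable {k : ℕ}

theorem exists_subset_of_isEmb (X : RSpace k) {ψ : List ℕ → List ℕ} (hψ : IsEmb k ψ) :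
    ∃ Y : RSpace k, Y.carrier = (X.emb ∘ ψ) '' tree k :=
  ⟨(X.isEmb_emb.comp hψ).toRSpace, rfl⟩

theorem le_of_subset {Y X : RSpace k} (h : Y.carrier ⊆ X.carrier) : Y ≤ X := by
  change (Y.carrier \ X.carrier).Finite
  rw [Set.sdiff_eq_empty.2 h]
  exact Set.finite_empty

theorem nil_mem (X : RSpace k) : [] ∈ X.carrier := by
  rw [← X.isEmb_emb.map_nil]; exact X.emb_mem (nil_mem_tree k)

/-- If `Y ≤* X` then all but finitely many blocks of `Y` are contained in `X`. -/
theorem exists_forall_emb_mem {Y X : RSpace k} (h : Y ≤ X) :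
    ∃ N, ∀ n y, N ≤ n → n :: y ∈ tree k → Y.emb (n :: y) ∈ X.carrier := by
  have hfin : (List.headI '' (Y.carrier \ X.carrier)).Finite := Set.Finite.image _ h
  obtain ⟨b, hb⟩ := hfin.bddAbove
  -- The finitely many missing nodes have first entries at most `b`, while the image of block `n`
  -- has first entry at least `n`.
  refine ⟨b + 1, fun n y hn hy => ?_⟩
  by_contra hX
  have := hb ⟨_, ⟨Y.emb_mem hy, hX⟩, rfl⟩
  obtain ⟨z, hz⟩ := Y.isEmb_emb.map_cons hy
  rw [hz, List.headI_cons] at this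
  have := Y.isEmb_emb.head_strictMono.id_le n
  simp only [id] at this
  omega

/-- If `Y ≤* X` then some member of `ℛ_k` is contained in both. -/
theorem exists_subset_inter {Y X : RSpace k} (h : Y ≤ X) :
    ∃ Z : RSpace k, Z.carrier ⊆ Y.carrier ∧ Z.carrier ⊆ X.carrier := by
  obtain ⟨N, hN⟩ := exists_forall_emb_mem h
  have hm : IsEmb k (glue (fun _ => Y.emb) fun n => N + n) :=
    isEmb_glue (fun _ => Y.isEmb_emb) (fun n => Nat.le_add_left n N) fun i j hij =>
      Y.isEmb_emb.head_strictMono (Nat.add_lt_add_left hij N)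
  refine ⟨hm.toRSpace, ?_, ?_⟩
  · rintro _ ⟨x, hx, rfl⟩
    cases x with
    | nil => exact Y.nil_mem
    | cons n y => exact Y.emb_mem (cons_mem_tree_of_le hx (Nat.le_add_left n N))
  · rintro _ ⟨x, hx, rfl⟩
    cases x with
    | nil => exact X.nil_mem
    | cons n y => exact hN _ _ (Nat.le_add_right N n) (cons_mem_tree_of_le hx (Nat.le_add_left n N))

/-- The forcing notion `(ℛ_k, ≤*)` is `σ`-closed. -/
theorem exists_le_forall (A : ℕ → RSpace k) (hA : ∀ i, A (i + 1) ≤ A i) :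
    ∃ B : RSpace k, ∀ i, B ≤ A i := by
  have hanti : Antitone A := antitone_nat_of_succ_le hA
  have hN : ∀ i, ∃ N, ∀ j ≤ i, ∀ n y, N ≤ n → n :: y ∈ tree k →
      (A i).emb (n :: y) ∈ (A j).carrier := by
    intro i
    choose N hN using fun j : Fin (i + 1) =>
      exists_forall_emb_mem (hanti (Nat.lt_succ_iff.1 j.2))
    refine ⟨Finset.univ.sup N, fun j hj n y hn hy => ?_⟩
    exact hN ⟨j, Nat.lt_succ_iff.2 hj⟩ n y
      ((Finset.le_sup (f := N) (Finset.mem_univ _)).trans hn) hy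
  choose N hN using hN
  have hstep : ∀ i b : ℕ, ∃ m, i ≤ m ∧ N i ≤ m ∧ b < IsEmb.head (A i).emb m := fun i b => by
    refine ⟨i + N i + b + 1, by omega, by omega, ?_⟩
    have := (A i).isEmb_emb.head_strictMono.id_le (i + N i + b + 1)
    simp only [id] at this
    omega
  choose f hf1 hf2 hf3 using hstep
  -- Diagonalisation: block `i` of the lower bound is taken from block `m i` of `A i`, so far out
  -- that it lies in every `A j` with `j ≤ i` and beyond the preceding block. Only the blocks `i <
  -- j` can then leave `A j`.
  let m : ℕ → ℕ := fun i => Nat.rec (f 0 0) (fun i p => f (i + 1) (IsEmb.head (A i).emb p)) i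
  have hm : ∀ i, ∃ b, m i = f i b := fun i => by
    cases i with
    | zero => exact ⟨0, rfl⟩
    | succ i => exact ⟨_, rfl⟩
  have hm1 : ∀ i, i ≤ m i := fun i => by obtain ⟨b, hb⟩ := hm i; rw [hb]; exact hf1 _ _
  have hm2 : ∀ i, N i ≤ m i := fun i => by obtain ⟨b, hb⟩ := hm i; rw [hb]; exact hf2 _ _
  have hglue : IsEmb k (glue (fun i => (A i).emb) m) :=
    isEmb_glue (fun i => (A i).isEmb_emb) hm1 (strictMono_nat_of_lt_succ fun i => hf3 _ _)
  refine ⟨hglue.toRSpace, fun j => ?_⟩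
  refine (((Set.finite_lt_nat j).biUnion fun i _ => finite_block k i).image
    (glue (fun i => (A i).emb) m)).subset ?_
  rintro _ ⟨⟨x, hx, rfl⟩, hnot⟩
  refine ⟨x, ?_, rfl⟩
  cases x with
  | nil => exact absurd (A j).nil_mem hnot
  | cons i y =>
    refine Set.mem_biUnion (x := i) ?_ (cons_mem_block.2 ⟨rfl, hx⟩)
    by_contra hij
    exact hnot (hN i j (not_lt.1 hij) _ _ (hm2 i) (cons_mem_tree_of_le hx (hm1 i)))

end RSpace

/-! ## First approximations and leaves -/

theorem mem_block_zero_iff {k : ℕ} {x : List ℕ} :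
    x ∈ block k 0 ↔ x <+: List.replicate (k + 1) 0 := by
  cases x with
  | nil => simp [nil_mem_block]
  | cons n y =>
    rw [cons_mem_block, List.replicate_succ, List.cons_prefix_cons]
    refine and_congr_right ?_
    rintro rfl
    constructor
    · intro h
      have hl := (mem_tree_iff.1 h).1
      rw [List.length_cons] at hl
      rw [List.eq_replicate_of_mem (mem_tree_zero_iff h)]
      exact ⟨List.replicate (k - y.length) 0, by
        rw [List.replicate_append_replicate]; congr 1; omega⟩
    · intro h
      have h0 : List.replicate (k + 1) 0 ∈ tree k :=
        mem_tree_iff.2 ⟨by simp, List.pairwise_replicate.2 (Or.inr le_rfl)⟩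
      exact mem_tree_of_isPrefix h0 (List.cons_prefix_cons.2 ⟨rfl, h⟩)

theorem replicate_mem_leaves (k : ℕ) : List.replicate (k + 1) 0 ∈ leaves k :=
  ⟨mem_tree_iff.2 ⟨by simp, List.pairwise_replicate.2 (Or.inr le_rfl)⟩, by simp⟩

theorem IsEmb.mem_leaves {k : ℕ} {φ : List ℕ → List ℕ} (hφ : IsEmb k φ) {x : List ℕ}
    (hx : x ∈ leaves k) : φ x ∈ leaves k :=
  ⟨hφ.mem x hx.1, (hφ.length x hx.1).trans hx.2⟩

theorem RSpace.approx_one {k : ℕ} (X : RSpace k) :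
    X.approx 1 = {x | x <+: X.emb (List.replicate (k + 1) 0)} := by
  have h0 := (replicate_mem_leaves k).1
  have : X.approx 1 = X.sub 0 := by simp [RSpace.approx]
  rw [this, X.sub_eq]
  ext z
  constructor
  · rintro ⟨x, hx, rfl⟩
    exact X.isEmb_emb.pre _ (block_subset_tree _ _ hx) _ h0 (mem_block_zero_iff.1 hx)
  · intro hz
    refine ⟨(List.replicate (k + 1) 0).take z.length,
      mem_block_zero_iff.2 (take_isPrefix _ _), ?_⟩
    rw [X.isEmb_emb.map_take h0, ← List.prefix_iff_eq_take.1 hz]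

theorem setOf_prefix_injective {u v : List ℕ} (h : {x | x <+: u} = {x | x <+: v}) : u = v := by
  have h1 : u ∈ {x | x <+: v} := h ▸ List.prefix_rfl
  have h2 : v ∈ {x | x <+: u} := h.symm ▸ List.prefix_rfl
  exact List.IsPrefix.eq_of_length h1 (le_antisymm h1.length_le h2.length_le)

theorem exists_leaf {k : ℕ} (a : AR1 k) : ∃ u ∈ leaves k, (a : Set (List ℕ)) = {x | x <+: u} := by
  obtain ⟨a, A, rfl⟩ := a
  exact ⟨_, A.isEmb_emb.mem_leaves (replicate_mem_leaves k), A.approx_one⟩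

/-- The leaf of a first approximation. -/
noncomputable def leafOf {k : ℕ} (a : AR1 k) : List ℕ := (exists_leaf a).choose

theorem leafOf_mem {k : ℕ} (a : AR1 k) : leafOf a ∈ leaves k := (exists_leaf a).choose_spec.1

theorem coe_eq_setOf_prefix_leafOf {k : ℕ} (a : AR1 k) :
    (a : Set (List ℕ)) = {x | x <+: leafOf a} := (exists_leaf a).choose_spec.2

theorem leafOf_injective (k : ℕ) : Function.Injective (leafOf : AR1 k → List ℕ) := fun a b h =>
  Subtype.ext (by rw [coe_eq_setOf_prefix_leafOf a, coe_eq_setOf_prefix_leafOf b, h])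

instance (k : ℕ) : Countable (AR1 k) := (leafOf_injective k).countable

theorem RSpace.exists_approx_one {k : ℕ} (X : RSpace k) {u : List ℕ} (hu : u ∈ X.carrier)
    (hlen : u.length = k + 1) : ∃ Y : RSpace k, Y.Red X ∧ Y.approx 1 = {x | x <+: u} := by
  rw [X.carrier_eq] at hu
  obtain ⟨v, hv, rfl⟩ := hu
  have hvl : v ∈ leaves k := ⟨hv, by rw [← X.isEmb_emb.length v hv, hlen]⟩
  have hs := isEmb_startAt hvl
  have hsub : (X.isEmb_emb.comp hs).toRSpace.carrier ⊆ X.carrier := by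
    rintro _ ⟨x, hx, rfl⟩
    exact X.emb_mem (hs.mem x hx)
  refine ⟨(X.isEmb_emb.comp hs).toRSpace, RSpace.red_iff.2 hsub, ?_⟩
  have hstart : startAt v (List.replicate (k + 1) 0) = v := by
    rw [List.replicate_succ, startAt, List.length_replicate, ← hvl.2, List.take_length]
  have hsub0 : (X.isEmb_emb.comp hs).toRSpace.approx 1 = (X.emb ∘ startAt v) '' block k 0 := by
    have : (X.isEmb_emb.comp hs).toRSpace.approx 1 = (X.isEmb_emb.comp hs).toRSpace.sub 0 := by
      simp [RSpace.approx]
    rw [this]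
    exact (X.isEmb_emb.comp hs).image_inter_block 0
  have h0 := (replicate_mem_leaves k).1
  rw [hsub0]
  ext z
  constructor
  · rintro ⟨x, hx, rfl⟩
    have := (X.isEmb_emb.comp hs).pre _ (block_subset_tree _ _ hx) _ h0 (mem_block_zero_iff.1 hx)
    simpa [Function.comp, hstart] using this
  · intro hz
    refine ⟨(List.replicate (k + 1) 0).take z.length,
      mem_block_zero_iff.2 (take_isPrefix _ _), ?_⟩
    rw [(X.isEmb_emb.comp hs).map_take h0, Function.comp_apply, hstart,
      ← List.prefix_iff_eq_take.1 hz]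

/-- From here on, `AR1Below X` can be replaced by the set of leaves in `X`. -/
theorem mem_AR1Below_iff {k : ℕ} {X : RSpace k} {a : AR1 k} :
    a ∈ AR1Below X ↔ leafOf a ∈ X.carrier := by
  constructor
  · rintro ⟨Y, hY, ha⟩
    rw [coe_eq_setOf_prefix_leafOf, Y.approx_one] at ha
    rw [setOf_prefix_injective ha]
    exact RSpace.red_iff.1 hY (Y.emb_mem (replicate_mem_leaves k).1)
  · intro h
    obtain ⟨Y, hY, hu⟩ := X.exists_approx_one h (leafOf_mem a).2
    exact ⟨Y, hY, by rw [hu, coe_eq_setOf_prefix_leafOf]⟩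

theorem AR1Below_mono {k : ℕ} {X Y : RSpace k} (h : Y.carrier ⊆ X.carrier) :
    AR1Below Y ⊆ AR1Below X := fun _ ha => mem_AR1Below_iff.2 (h (mem_AR1Below_iff.1 ha))

theorem AR1Below_nonempty {k : ℕ} (X : RSpace k) : (AR1Below X).Nonempty :=
  ⟨⟨X.approx 1, X, rfl⟩, X, RSpace.red_iff.2 Set.Subset.rfl, rfl⟩

theorem exists_leafOf_eq {k : ℕ} {u : List ℕ} (hu : u ∈ leaves k) : ∃ a : AR1 k, leafOf a = u := by
  have hid : IsEmb k id := ⟨fun _ h => h, fun _ _ => rfl, fun _ _ _ _ h => h, fun _ _ _ _ h => h⟩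
  obtain ⟨Y, -, hY⟩ := hid.toRSpace.exists_approx_one (u := u) ⟨u, hu.1, rfl⟩ hu.2
  refine ⟨⟨_, Y, rfl⟩, setOf_prefix_injective ?_⟩
  exact (coe_eq_setOf_prefix_leafOf _).symm.trans hY

/-! ### Finite sets of first approximations as increasing sequences of leaves -/

/-- The leaves of the members of a finite set of first approximations, in lexicographic order. -/
noncomputable def leafSeq {k n : ℕ} (s : Subsets (AR1 k) n) : Fin n → List ℕ :=
  (s.1.map ⟨leafOf, leafOf_injective k⟩).orderEmbOfFin (by rw [Finset.card_map, s.2])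

variable {k n : ℕ}

theorem leafSeq_strictMono (s : Subsets (AR1 k) n) : StrictMono (leafSeq s) :=
  (Finset.orderEmbOfFin _ _).strictMono

theorem range_leafSeq (s : Subsets (AR1 k) n) :
    Set.range (leafSeq s) = leafOf '' (s.1 : Set (AR1 k)) := by
  unfold leafSeq
  rw [Finset.range_orderEmbOfFin, Finset.coe_map]
  rfl

theorem leafSeq_mem_leaves (s : Subsets (AR1 k) n) (i : Fin n) : leafSeq s i ∈ leaves k := by
  have : leafSeq s i ∈ Set.range (leafSeq s) := ⟨i, rfl⟩
  rw [range_leafSeq] at this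
  obtain ⟨a, -, ha⟩ := this
  rw [← ha]
  exact leafOf_mem a

theorem leafSeq_injective : Function.Injective (leafSeq : Subsets (AR1 k) n → _) := fun s s' h => by
  have := range_leafSeq s
  rw [h, range_leafSeq, (leafOf_injective k).image_injective.eq_iff] at this
  exact Subtype.ext (Finset.coe_injective this.symm)

theorem forall_mem_AR1Below_iff {B : RSpace k} {s : Subsets (AR1 k) n} :
    (∀ a ∈ s.1, a ∈ AR1Below B) ↔ ∀ i, leafSeq s i ∈ B.carrier := by
  rw [← Set.forall_mem_range (p := fun x => x ∈ B.carrier), range_leafSeq, Set.forall_mem_image]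
  simp only [mem_AR1Below_iff, Finset.mem_coe]

theorem exists_leafSeq_eq {t : Fin n → List ℕ} (ht : ∀ i, t i ∈ leaves k) (hm : StrictMono t) :
    ∃ s : Subsets (AR1 k) n, leafSeq s = t := by
  choose a ha using fun i => exists_leafOf_eq (ht i)
  have hinj : Function.Injective a := fun i j h => hm.injective (by rw [← ha i, ← ha j, h])
  refine ⟨⟨Finset.univ.map ⟨a, hinj⟩, by simp⟩, ?_⟩
  refine (Finset.orderEmbOfFin_unique _ (fun i => ?_) hm).symm
  simp only [Finset.mem_map, Finset.mem_univ, true_and, Function.Embedding.coeFn_mk]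
  exact ⟨a i, ⟨i, rfl⟩, ha i⟩

/-- Every finite colouring of the `n`-element sets of first approximations is canonical below some
member of `ℛ_k`. -/
theorem exists_canonical {κ : Type*} [Finite κ] [Nonempty κ] (A : RSpace k)
    (c : Subsets (AR1 k) n → κ) :
    ∃ B : RSpace k, B.carrier ⊆ A.carrier ∧ ∀ s s' : Subsets (AR1 k) n,
      (∀ a ∈ s.1, a ∈ AR1Below B) → (∀ a ∈ s'.1, a ∈ AR1Below B) →
      meetType k (leafSeq s) = meetType k (leafSeq s') → c s = c s' := by
  -- The colouring is transported to tuples of leaves through the embedding of `A`; tuples that are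
  -- not a `leafSeq` get an arbitrary colour.
  obtain ⟨φ, hφ, hC⟩ := leaf_ramsey k n fun t =>
    Function.extend leafSeq c (fun _ => Classical.arbitrary κ) (A.emb ∘ t)
  obtain ⟨B, hB⟩ := A.exists_subset_of_isEmb hφ
  refine ⟨B, ?_, fun s s' hs hs' heq => ?_⟩
  · rw [hB]
    rintro _ ⟨x, hx, rfl⟩
    exact A.emb_mem (hφ.mem x hx)
  have hcomp := A.isEmb_emb.comp hφ
  have hpull : ∀ s : Subsets (AR1 k) n, (∀ a ∈ s.1, a ∈ AR1Below B) →
      ∃ t : Fin n → List ℕ, (∀ i, t i ∈ leaves k) ∧ StrictMono t ∧ leafSeq s = A.emb ∘ φ ∘ t := by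
    intro s hs
    rw [forall_mem_AR1Below_iff, hB] at hs
    choose t ht hts using hs
    refine ⟨t, fun i => ⟨ht i, ?_⟩, fun i j hij => ?_, funext fun i => (hts i).symm⟩
    · rw [← hcomp.length _ (ht i), hts, (leafSeq_mem_leaves s i).2]
    · rw [← hcomp.lt_iff (ht i) (ht j), hts, hts]
      exact leafSeq_strictMono s hij
  obtain ⟨t, ht, htm, hts⟩ := hpull s hs
  obtain ⟨t', ht', htm', hts'⟩ := hpull s' hs'
  have hty : meetType k t = meetType k t' := by
    have h1 := hcomp.meetType_comp fun i => (ht i).1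
    have h2 := hcomp.meetType_comp fun i => (ht' i).1
    rw [← h1, ← h2]
    rwa [hts, hts'] at heq
  have := hC t t' ht ht' htm htm' (take_eq_iff_of_meetType_eq ht ht' htm htm' hty)
  rwa [← hts, ← hts', leafSeq_injective.extend_apply, leafSeq_injective.extend_apply] at this

/-- Every type is realised below every member of `ℛ_k`. -/
theorem exists_subset_meetType (A : RSpace k) (τ : Fin (n - 1) → Fin (k + 1)) :
    ∃ s : Subsets (AR1 k) n, (∀ a ∈ s.1, a ∈ AR1Below A) ∧ meetType k (leafSeq s) = τ := by
  obtain ⟨t, ht, hm, hτ⟩ := exists_leaves_meetType k n τ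
  obtain ⟨s, hs⟩ := exists_leafSeq_eq (t := A.emb ∘ t)
    (fun i => A.isEmb_emb.mem_leaves (ht i))
    fun i j hij => A.isEmb_emb.lt _ (ht i).1 _ (ht j).1 (hm hij)
  refine ⟨s, forall_mem_AR1Below_iff.2 fun i => ?_, ?_⟩
  · rw [hs]; exact A.emb_mem (ht i).1
  · rw [hs, A.isEmb_emb.meetType_comp fun i => (ht i).1, hτ]

open Sentence

/-! ## Forcing with `(ℛ_k, ≤*)` and its completions -/

namespace Sentence

variable {P : Type*} [Preorder P] {α : Type*} {a : α} {τ : Name α P}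

theorem mem.mono {p q : P} (h : mem a τ p) (hq : q ≤ p) : mem a τ q :=
  fun r hr => h r (hr.trans hq)

theorem mem_of_mem {p : P} (h : (a, p) ∈ τ) : mem a τ p := fun q hq => ⟨q, le_rfl, p, h, hq⟩

theorem mem_or_neg_below (a : α) (τ : Name α P) (p : P) :
    ∃ q ≤ p, mem a τ q ∨ neg (mem a τ) q := by
  by_cases h : neg (mem a τ) p
  · exact ⟨p, le_rfl, Or.inr h⟩
  · simp only [neg, not_forall, not_not] at h
    obtain ⟨q, hq, h⟩ := h
    exact ⟨q, hq, Or.inl h⟩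

/-- A condition that decides membership in a name forces it as soon as no extension refutes it. -/
theorem mem_of_decided {p q : P} (h : mem a τ p ∨ neg (mem a τ) p) (hq : q ≤ p)
    (hm : mem a τ q) : mem a τ p := h.resolve_right fun hn => hn q hq hm

end Sentence

/-- The name of the ground model set `D`. -/
def groundName {α : Type*} (P : Type*) (D : Set α) : Name α P := {x | x.1 ∈ D}

theorem mem_groundName_iff {α P : Type*} [Preorder P] {D : Set α} {a : α} {p : P} :
    mem a (groundName P D) p ↔ a ∈ D := by
  constructor
  · intro h
    obtain ⟨r, -, s, hs, -⟩ := h p le_rfl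
    exact hs
  · exact fun h => mem_of_mem h

variable {k n : ℕ} {Q : Type*} [Preorder Q] {e : RSpace k → Q}

namespace IsDenseEmb

/-- Choose `p` with `e p ≤ q`. As `e p` lies below both `e p` and `e A`, the conditions `p` and `A`
are compatible, and a common extension serves as `B`. -/
theorem exists_le_of_le (he : IsDenseEmb e) {q : Q} {A : RSpace k} (h : q ≤ e A) :
    ∃ B ≤ A, e B ≤ q := by
  obtain ⟨p, hp⟩ := he.dense q
  by_contra! hno
  refine he.incompatible p A ?_ ⟨e p, le_rfl, hp.trans h⟩
  rintro ⟨r, hr, hrA⟩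
  exact hno r hrA ((he.mono _ _ hr).trans hp)

/-- Below every condition there is one that decides a given name for a subset of a countable
set. -/
theorem exists_decides (he : IsDenseEmb e) {T : Type*} [Countable T] (X : Name T Q) (q : Q) :
    ∃ A : RSpace k, e A ≤ q ∧ ∀ t, mem t X (e A) ∨ neg (mem t X) (e A) := by
  obtain ⟨A₀, hA₀⟩ := he.dense q
  rcases isEmpty_or_nonempty T with hT | hT
  · exact ⟨A₀, hA₀, fun t => isEmptyElim t⟩
  obtain ⟨f, hf⟩ := exists_surjective_nat T
  have hstep : ∀ (t : T) (A : RSpace k), ∃ B ≤ A, mem t X (e B) ∨ neg (mem t X) (e B) := by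
    intro t A
    obtain ⟨r, hr, h⟩ := mem_or_neg_below t X (e A)
    obtain ⟨B, hB, hBr⟩ := he.exists_le_of_le hr
    exact ⟨B, hB, h.imp (fun h => h.mono hBr) fun h s hs => h s (hs.trans hBr)⟩
  choose next hle hdec using hstep
  -- The elements of `T` are decided one at a time along a descending sequence; a lower bound
  -- decides them all.
  let A : ℕ → RSpace k := fun i => Nat.rec A₀ (fun i B => next (f i) B) i
  obtain ⟨B, hB⟩ := RSpace.exists_le_forall A fun i => hle _ _
  refine ⟨B, (he.mono _ _ (hB 0)).trans hA₀, fun t => ?_⟩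
  obtain ⟨i, rfl⟩ := hf t
  have hBi := he.mono _ _ (hB (i + 1))
  exact (hdec (f i) (A i)).imp (fun h => h.mono hBi) fun h s hs => h s (hs.trans hBi)

end IsDenseEmb

/-- A condition forcing `X ∈ 𝒰_k` has an extension `e A` with `𝒜ℛ_1 ↾ A ⊆ X`. -/
theorem forcedU.exists_below (he : IsDenseEmb e) {X : Name (AR1 k) Q} {p : Q}
    (h : forcedU e X p) : ∃ A : RSpace k, e A ≤ p ∧ ∀ a ∈ AR1Below A, mem a X (e A) := by
  obtain ⟨r, hr, A, hA, hX⟩ := h p le_rfl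
  obtain ⟨s, hs, q, hq, hsA⟩ := hA r le_rfl
  obtain rfl : q = e A := hq
  obtain ⟨B, hBA, hB⟩ := he.exists_le_of_le hsA
  -- `B ≤ A` is only almost inclusion; `AR1Below C ⊆ AR1Below A` needs true inclusion.
  obtain ⟨C, hCB, hCA⟩ := RSpace.exists_subset_inter hBA
  have hC : e C ≤ r := ((he.mono _ _ (RSpace.le_of_subset hCB)).trans hB).trans hs
  exact ⟨C, hC.trans hr, fun a ha => (hX ⟨a, AR1Below_mono hCA ha⟩).mono hC⟩

theorem forcedU_of_below {X : Name (AR1 k) Q} {A : RSpace k}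
    (h : ∀ a ∈ AR1Below A, mem a X (e A)) : forcedU e X (e A) := fun q hq =>
  ⟨q, le_rfl, A, mem.mono (mem_of_mem (show (A, e A) ∈ genericName e from rfl)) hq,
    fun a => (h a.1 a.2).mono hq⟩

theorem forcedU.mono {X : Name (AR1 k) Q} {p q : Q} (h : forcedU e X p) (hq : q ≤ p) :
    forcedU e X q := fun r hr => h r (hr.trans hq)

/-- It is enough to find densely many `e A` with `𝒜ℛ_1 ↾ A ⊆ X`. -/
theorem forcedU_of_dense {X : Name (AR1 k) Q} {p : Q}
    (h : ∀ q ≤ p, ∃ A : RSpace k, e A ≤ q ∧ ∀ a ∈ AR1Below A, mem a X (e A)) :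
    forcedU e X p := fun q hq => by
  obtain ⟨A, hA, hX⟩ := h q hq
  obtain ⟨r, hr, B, hB⟩ := forcedU_of_below hX (e A) le_rfl
  exact ⟨r, hr.trans hA, B, hB⟩

/-- Some member of `ℛ_k` below `A` is homogeneous for a given subset of `𝒜ℛ_1`. -/
theorem exists_homogeneous (A : RSpace k) (D : Set (AR1 k)) :
    ∃ B : RSpace k, B.carrier ⊆ A.carrier ∧ (AR1Below B ⊆ D ∨ AR1Below B ⊆ Dᶜ) := by
  -- One-element sets have no consecutive pairs, hence a single type: canonical means constant.
  obtain ⟨B, hBA, hB⟩ := exists_canonical (n := 1) A fun s => ∃ a ∈ s.1, a ∈ D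
  refine ⟨B, hBA, ?_⟩
  have key : ∀ a ∈ AR1Below B, ∀ b ∈ AR1Below B, a ∈ D → b ∈ D := by
    intro a ha b hb haD
    have := hB ⟨{a}, Finset.card_singleton a⟩ ⟨{b}, Finset.card_singleton b⟩ (by simpa using ha)
      (by simpa using hb) (funext fun i => i.elim0)
    simp only [Finset.mem_singleton, exists_eq_left] at this
    rwa [← this]
  obtain ⟨a, ha⟩ := AR1Below_nonempty B
  by_cases haD : a ∈ D
  · exact Or.inl fun b hb => key a ha b hb haD
  · exact Or.inr fun b hb hbD => haD (key b hb a ha hbD)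

/-! ### The forced ultrafilter and its Ramsey degree -/

theorem forced_isUltrafilter (he : IsDenseEmb e) : Forced (isUltrafilter (forcedU e)) := by
  refine fun p => ⟨?_, ?_, ?_, ?_, ?_⟩
  · intro X q _ hX
    refine forcedU_of_dense fun r hr => ?_
    obtain ⟨A, hA⟩ := he.dense r
    exact ⟨A, hA, fun a _ => (hX a).mono (hA.trans hr)⟩
  · intro X q _ hX r hr hU
    obtain ⟨A, hA, hAX⟩ := hU.exists_below he
    obtain ⟨a, ha⟩ := AR1Below_nonempty A
    exact hX a (e A) (hA.trans hr) (hAX a ha)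
  · rintro X Y q _ ⟨hU, hXY⟩
    refine forcedU_of_dense fun r hr => ?_
    obtain ⟨A, hA, hAX⟩ := (hU.mono hr).exists_below he
    exact ⟨A, hA, fun a ha => hXY a (e A) (hA.trans hr) (hAX a ha)⟩
  · rintro X Y Z q _ ⟨⟨hX, hY⟩, hZ⟩
    refine forcedU_of_dense fun r hr => ?_
    obtain ⟨A, hA, hAX⟩ := (hX.mono hr).exists_below he
    obtain ⟨B, hB, hBY⟩ := (hY.mono (hA.trans hr)).exists_below he
    -- A dense embedding need not reflect the order, so `e B ≤ e A` yields only the compatibility of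
    -- `A` and `B`.
    obtain ⟨C, hCA, hCB⟩ : ∃ C, C ≤ A ∧ C ≤ B := by
      by_contra hno
      exact he.incompatible A B hno ⟨e B, hB, le_rfl⟩
    obtain ⟨D, hDC, hDA⟩ := RSpace.exists_subset_inter hCA
    obtain ⟨E, hED, hEB⟩ := RSpace.exists_subset_inter ((RSpace.le_of_subset hDC).trans hCB)
    have hEA := he.mono _ _ (RSpace.le_of_subset (hED.trans hDA))
    have hEB' := he.mono _ _ (RSpace.le_of_subset hEB)
    refine ⟨E, hEA.trans hA, fun a ha => (hZ a).2 (e E) ((hEA.trans hA).trans hr) ⟨?_, ?_⟩⟩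
    · exact (hAX a (AR1Below_mono (hED.trans hDA) ha)).mono hEA
    · exact (hBY a (AR1Below_mono hEB ha)).mono hEB'
  · intro X Y q _ hXY r hr
    -- Once `e A` decides the name `X`, it acts below `e A` as a ground model set, for which a
    -- homogeneous member exists.
    obtain ⟨A, hA, hdec⟩ := he.exists_decides X r
    obtain ⟨B, hBA, hB⟩ := exists_homogeneous A {a | mem a X (e A)}
    have hle : e B ≤ e A := he.mono _ _ (RSpace.le_of_subset hBA)
    refine ⟨e B, hle.trans hA, hB.imp (fun h => ?_) fun h => ?_⟩
    · exact forcedU_of_below fun a ha => mem.mono (h ha) hle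
    · refine forcedU_of_below fun a ha => (hXY a).2 (e B) ((hle.trans hA).trans hr) ?_
      intro s hs hm
      exact h ha (mem_of_decided (hdec a) (hs.trans hle) hm)

/-- Below a condition deciding `c`, the colouring is a ground model function `g`; a canonical `B`
then needs only the colours of one representative of each type. -/
theorem forced_isRamseyBound (he : IsDenseEmb e) :
    Forced (isRamseyBound (forcedU e) n ((k + 1) ^ (n - 1))) := by
  classical
  rintro p ⟨l, hl⟩ c q _ ⟨hc, -⟩ r hr
  have : Nonempty (Fin l) := ⟨⟨0, by omega⟩⟩
  obtain ⟨A, hA, hdec⟩ := he.exists_decides c r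
  have hcol : ∀ s, ∃ i, mem (s, i) c (e A) := by
    intro s
    obtain ⟨u, hu, i, hi⟩ := hc s (e A) (hA.trans hr)
    exact ⟨i, mem_of_decided (hdec _) hu hi⟩
  choose g hg using hcol
  obtain ⟨B, hBA, hB⟩ := exists_canonical A g
  have hle : e B ≤ e A := he.mono _ _ (RSpace.le_of_subset hBA)
  choose rep hrep hrepτ using exists_subset_meetType (n := n) B
  let F : Finset (Fin l) := Finset.univ.image fun τ => g (rep τ)
  have hF : F.card ≤ (k + 1) ^ (n - 1) :=
    Finset.card_image_le.trans_eq (by simp)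
  refine ⟨e B, hle.trans hA, groundName Q (AR1Below B),
    forcedU_of_below fun a ha => mem_groundName_iff.2 ha, fun u hu => ⟨u, le_rfl, ⟨F, hF⟩, ?_⟩⟩
  intro s v hv hs w hw
  have hsB : ∀ a ∈ s.1, a ∈ AR1Below B := fun a ha => mem_groundName_iff.1 (hs ⟨a, ha⟩)
  have hsF : g s ∈ F := Finset.mem_image.2 ⟨meetType k (leafSeq s), Finset.mem_univ _,
    hB _ _ (hrep _) hsB (hrepτ _)⟩
  exact ⟨w, le_rfl, ⟨g s, hsF⟩, (hg s).mono (hw.trans (hv.trans (hu.trans hle)))⟩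

/-- The ground model colouring by types witnesses this: a set in the ultrafilter contains `AR1Below
A` for some condition `e A`, where every type occurs. -/
theorem forced_neg_isRamseyBound (he : IsDenseEmb e) {t : ℕ} (ht : t < (k + 1) ^ (n - 1)) :
    Forced (neg (isRamseyBound (forcedU e) n t)) := by
  intro p q _ hbound
  let E : (Fin (n - 1) → Fin (k + 1)) ≃ Fin ((k + 1) ^ (n - 1)) :=
    Fintype.equivFinOfCardEq (by simp)
  -- One unused colour is added because colourings need at least two colours, while there may be
  -- just one type.
  let col : Subsets (AR1 k) n → Fin ((k + 1) ^ (n - 1) + 1) :=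
    fun s => (E (meetType k (leafSeq s))).castSucc
  let c : Name (Subsets (AR1 k) n × Fin ((k + 1) ^ (n - 1) + 1)) Q := groundName Q {x | x.2 = col x.1}
  have hc : isColoring c q := by
    refine ⟨fun s r _ => ⟨r, le_rfl, col s, mem_groundName_iff.2 rfl⟩, fun s i j r _ h => ?_⟩
    have h1 : i = col s := mem_groundName_iff.1 h.1
    have h2 : j = col s := mem_groundName_iff.1 h.2
    exact h1.trans h2.symm
  obtain ⟨r, hr, X, hX, hcolors⟩ := hbound ⟨_, Nat.succ_le_succ (Nat.one_le_pow _ _ k.succ_pos)⟩ c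
    q le_rfl hc q le_rfl
  obtain ⟨u, hu, ⟨F, hF⟩, hcF⟩ := hcolors r le_rfl
  obtain ⟨A, hA, hAX⟩ := (hX.mono hu).exists_below he
  have hsub : Finset.univ.map (Fin.castSuccEmb (n := (k + 1) ^ (n - 1))) ⊆ F := by
    intro i hi
    obtain ⟨i, -, rfl⟩ := Finset.mem_map.1 hi
    obtain ⟨s, hs, hsτ⟩ := exists_subset_meetType A (E.symm i)
    obtain ⟨w, -, j, hj⟩ := hcF s (e A) hA (fun a => hAX _ (hs a.1 a.2)) (e A) le_rfl
    have hjs : j.1 = col s := mem_groundName_iff.1 hj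
    have : col s = i.castSucc := by simp [col, hsτ]
    have hjF := j.2
    rw [hjs, this] at hjF
    exact hjF
  have := Finset.card_le_card hsub
  rw [Finset.card_map, Finset.card_univ, Fintype.card_fin] at this
  omega

theorem forced_hasRamseyDegree (he : IsDenseEmb e) :
    Forced (hasRamseyDegree (forcedU e) n ((k + 1) ^ (n - 1))) := fun p =>
  ⟨forced_isRamseyBound he p, fun t => forced_neg_isRamseyBound he t.2 p⟩

theorem isDenseEmb_id (k : ℕ) : IsDenseEmb (id : RSpace k → RSpace k) :=
  ⟨fun _ _ h => h, fun _ _ h => h, fun q => ⟨q, le_rfl⟩⟩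

end LaflammeRamsey

theorem mainTheorem2 (n : ℕ) (hn : 1 ≤ n) :
    -- the forcing notion `(ℛ_k, ≤*)`
    (∀ k : ℕ, 1 ≤ k →
      LaflammeRamsey.Forced (LaflammeRamsey.Sentence.conj
        (LaflammeRamsey.isUltrafilter
          (LaflammeRamsey.forcedU (id : LaflammeRamsey.RSpace k → LaflammeRamsey.RSpace k)))
        (LaflammeRamsey.hasRamseyDegree
          (LaflammeRamsey.forcedU (id : LaflammeRamsey.RSpace k → LaflammeRamsey.RSpace k))
          n ((k + 1) ^ (n - 1))))) ∧
    -- every forcing notion into which `(ℛ_k, ≤*)` embeds densely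
    (∀ k : ℕ, 1 ≤ k → ∀ (Q : Type*) [Preorder Q] (e : LaflammeRamsey.RSpace k → Q),
      LaflammeRamsey.IsDenseEmb e →
      LaflammeRamsey.Forced (LaflammeRamsey.Sentence.conj
        (LaflammeRamsey.isUltrafilter (LaflammeRamsey.forcedU e))
        (LaflammeRamsey.hasRamseyDegree (LaflammeRamsey.forcedU e)
          n ((k + 1) ^ (n - 1))))) ∧
    -- the case `k = 1`
    LaflammeRamsey.Forced (LaflammeRamsey.hasRamseyDegree
      (LaflammeRamsey.forcedU (id : LaflammeRamsey.RSpace 1 → LaflammeRamsey.RSpace 1))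
      n (2 ^ (n - 1))) := by
  open LaflammeRamsey in
  exact ⟨fun k _ p => ⟨forced_isUltrafilter (isDenseEmb_id k) p,
      forced_hasRamseyDegree (isDenseEmb_id k) p⟩,
    fun k _ Q _ e he p => ⟨forced_isUltrafilter he p, forced_hasRamseyDegree he p⟩,
    forced_hasRamseyDegree (isDenseEmb_id 1)⟩
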